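/- All graphs are finite and simple. A star forest is a forest without paths of length $3$ (length is the number of edges). An injective cover of a graph $G=(V,E)$ by star forests consists of finitely many star forests $T_1,\dots,T_k$ and a homomorphism $\varphi$ from the disjoint union $T_1\mathbin{\dot\cup}\cdots\mathbin{\dot\cup}T_k$ to $G$ such that every edge of $G$ is the image of an edge and the restriction of $\varphi$ to each $T_i$ is injective. The local star arboricity of $G$ is $$\mathrm{sa}_\ell(G)=\min\Bigl\{\max_{v\in V}|\varphi^{-1}(v)| \;:\; \varphi \text{ is an injective cover of } G \text{ by star forests}\Bigr\}$$ (and it is $0$ if $G$ has no vertices). **Theorem.** The local star arboricity can be computed in polynomial time. That is, there are a (multi-stack) Turing machine $M$ and a polynomial $q$ such that for every $n\ge 0$ and every graph $G$ with vertex set $\{0,\dots,n-1\}$, given to $M$ as the string $x$ that lists the rows of the adjacency matrix of $G$, each row followed by an end marker, $M$ halts after at most $q(|x|)$ steps with output the binary representation (least significant bit first, the empty string for $0$) of $\mathrm{sa}_\ell(G)$. -/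

import Mathlib

namespace GraphCover

/-- A class of (finite) template graphs, given by its members on the vertex sets `Fin m`. -/
abbrev TemplateClass := ∀ m : ℕ, Set (SimpleGraph (Fin m))

/-- A cover of `G` with respect to the template class `𝒯`: finitely many template graphs together
with an edge-surjective homomorphism from their disjoint union to `G`. A homomorphism from a
disjoint union is given by its restrictions `hom i` to the individual templates. -/
structure Cover {V : Type*} (𝒯 : TemplateClass) (G : SimpleGraph V) where
  /-- the number of template graphs -/
  size : ℕ
  /-- the number of vertices of each template graph -/
  order : Fin size → ℕ
  /-- the template graphs -/
  template : ∀ i, SimpleGraph (Fin (order i))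
  template_mem : ∀ i, template i ∈ 𝒯 (order i)
  /-- the homomorphism, restricted to each template graph -/
  hom : ∀ i, template i →g G
  edge_surjective : ∀ u v, G.Adj u v →
    ∃ i x y, (template i).Adj x y ∧ hom i x = u ∧ hom i y = v

namespace Cover

variable {V : Type*} {𝒯 : TemplateClass} {G : SimpleGraph V}

/-- The map from the vertex set of the disjoint union of the templates to the vertex set of `G`. -/
def toFun (φ : Cover 𝒯 G) (x : Σ i : Fin φ.size, Fin (φ.order i)) : V := φ.hom x.1 x.2

/-- A cover is injective if its restriction to every single template graph is injective. -/
def IsInjective (φ : Cover 𝒯 G) : Prop := ∀ i, Function.Injective (φ.hom i)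

/-- The maximum over all vertices `v` of `G` of the number of preimages of `v`
(it is `0` if `G` has no vertices). -/
noncomputable def maxPreimages (φ : Cover 𝒯 G) : ℕ∞ := ⨆ v : V, (φ.toFun ⁻¹' {v}).encard

end Cover

/-- The local covering number: the minimum of `maxPreimages` over all injective covers
(it is `⊤` if there is no injective cover). -/
noncomputable def localCoveringNumber {V : Type*} (𝒯 : TemplateClass) (G : SimpleGraph V) : ℕ∞ :=
  ⨅ (φ : Cover 𝒯 G) (_ : φ.IsInjective), φ.maxPreimages

/-- A star forest is a forest without paths of length `3`, where the length of a path is its number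
of edges. -/
def IsStarForest {W : Type*} (T : SimpleGraph W) : Prop :=
  T.IsAcyclic ∧ ∀ (u v : W) (p : T.Walk u v), p.IsPath → p.length ≠ 3

/-- The template class of star forests. -/
def starForests : TemplateClass := fun _ => {T | IsStarForest T}

/-- The local star arboricity of a finite graph. The local covering number with respect to star
forests is finite for every finite graph, see `coe_localStarArboricity`. -/
noncomputable def localStarArboricity {V : Type*} (G : SimpleGraph V) : ℕ :=
  (localCoveringNumber starForests G).toNat

/-- A finite graph presented on the vertex set `Fin n`. -/
abbrev FiniteGraph := Σ n : ℕ, SimpleGraph (Fin n)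

open Classical in
/-- The `i`-th row of the adjacency matrix, as a string of bits. -/
noncomputable def adjRow {n : ℕ} (G : SimpleGraph (Fin n)) (i : Fin n) : List Bool :=
  (List.finRange n).map fun j => decide (G.Adj i j)

/-- Concatenation of bit strings, each one followed by the end marker `none`. -/
def encodeRows (L : List (List Bool)) : List (Option Bool) :=
  L.flatMap fun r => r.map some ++ [none]

/-- The encoding of a graph as a string over a three-letter alphabet: its adjacency matrix written
row by row, each row followed by the end marker `none`. A graph on `n` vertices is encoded by a
string of length `n * (n + 1)`. -/
noncomputable def encodeGraph (G : FiniteGraph) : List (Option Bool) :=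
  encodeRows ((List.finRange G.1).map (adjRow G.2))

theorem encodeRow_append_inj (r s : List Bool) (A B : List (Option Bool))
    (h : r.map some ++ none :: A = s.map some ++ none :: B) : r = s ∧ A = B := by
  induction r generalizing s with
  | nil =>
    cases s with
    | nil => simpa using h
    | cons b s => simp at h
  | cons a r ih =>
    cases s with
    | nil => simp at h
    | cons b s =>
      simp only [List.map_cons, List.cons_append, List.cons.injEq, Option.some.injEq] at h
      obtain ⟨h1, h2⟩ := ih s h.2
      exact ⟨by rw [h.1, h1], h2⟩

theorem encodeRows_injective : Function.Injective encodeRows := by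
  intro L M h
  induction L generalizing M with
  | nil =>
    cases M with
    | nil => rfl
    | cons s M => simp [encodeRows] at h
  | cons r L ih =>
    cases M with
    | nil => simp [encodeRows] at h
    | cons s M =>
      simp only [encodeRows, List.flatMap_cons, List.append_assoc, List.cons_append,
        List.nil_append] at h
      obtain ⟨h1, h2⟩ := encodeRow_append_inj r s _ _ h
      rw [h1, ih h2]

theorem encodeGraph_injective : Function.Injective encodeGraph := by
  rintro ⟨n, G⟩ ⟨m, H⟩ h
  have h' := encodeRows_injective h
  have hn : n = m := by simpa using congrArg List.length h'
  subst hn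
  congr 1
  ext i j
  have h1 : adjRow G i = adjRow H i := List.map_inj_left.1 h' i (List.mem_finRange i)
  have h2 := List.map_inj_left.1 h1 j (List.mem_finRange j)
  simpa using h2

theorem length_encodeGraph (G : FiniteGraph) : (encodeGraph G).length = G.1 * (G.1 + 1) := by
  simp [encodeGraph, encodeRows, adjRow, Function.comp_def, List.length_flatMap]

/-- Every finite graph has an injective cover by star forests: take every single edge (once for each
orientation) as a template. -/
theorem exists_injective_cover {V : Type*} [Finite V] (G : SimpleGraph V) :
    ∃ φ : Cover starForests G, φ.IsInjective := by
  classical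
  have hfin : Finite G.Dart :=
    Finite.of_injective (fun d : G.Dart => d.toProd) SimpleGraph.Dart.toProd_injective
  obtain ⟨k, ⟨e⟩⟩ := Finite.exists_equiv_fin G.Dart
  refine ⟨⟨k, fun _ => 2, fun _ => ⊤, fun _ => ?_, fun i =>
    ⟨![(e.symm i).fst, (e.symm i).snd], ?_⟩, ?_⟩, ?_⟩
  · refine ⟨?_, ?_⟩
    · intro v c hc
      have h1 := hc.three_le_length
      have h2 := hc.support_nodup.length_le_card
      simp at h2
      omega
    · intro u v p hp h3
      have := hp.length_lt
      simp at this
      omega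
  · intro a b hab
    have := (e.symm i).adj
    fin_cases a <;> fin_cases b <;> simp_all [G.adj_comm]
  · intro u v huv
    exact ⟨e ⟨(u, v), huv⟩, 0, 1, by simp, by simp, by simp⟩
  · intro i a b hab
    have := (e.symm i).adj.ne
    change ![(e.symm i).fst, (e.symm i).snd] a = ![(e.symm i).fst, (e.symm i).snd] b at hab
    fin_cases a <;> fin_cases b <;> simp_all

theorem coe_localStarArboricity {V : Type*} [Finite V] (G : SimpleGraph V) :
    (localStarArboricity G : ℕ∞) = localCoveringNumber starForests G := by
  refine ENat.natCast_toNat ?_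
  obtain ⟨φ, hφ⟩ := exists_injective_cover G
  have h : localCoveringNumber starForests G ≤ Nat.card (Σ i : Fin φ.size, Fin (φ.order i)) := by
    refine (iInf₂_le φ hφ).trans (iSup_le fun v => ?_)
    rw [Nat.card_eq_fintype_card, ← ENat.card_eq_coe_fintype_card, ← Set.encard_univ]
    exact Set.encard_le_encard (Set.subset_univ _)
  exact ne_top_of_le_ne_top (ENat.natCast_ne_top _) h

end GraphCover

/-!
The local star arboricity of a graph `G` is determined by the orientations of `G`, and a suitable
orientation is found by a push-relabel algorithm.

*Orientations.* A cover of `G` by star forests in which every vertex has at most `k` preimages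
orients the edges of `G` from the leaves to the centres of the stars. A vertex of out-degree `k` has
only leaves as preimages and hence degree `k`. Conversely, an orientation yields one star around
each vertex, consisting of its in-neighbours, and a vertex `u` has one preimage for each edge that
leaves it, and one more if some edge enters it. Therefore `G` has local star arboricity at most `k`
if and only if it has an orientation in which every vertex of degree more than `k` has out-degree
less than `k` (`localStarArboricity_le_iff`). As an edge with an end of degree at most `k` can be
oriented away from that end for free, only the edges between vertices of degree more than `k` matter
(`core`).

*The algorithm.* Start with any orientation of these edges and with all heights `0`. As long as
possible, reverse an edge whose tail has out-degree at least `k` and lies one level above its head;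
if there is no such edge, lift a vertex that has out-degree at least `k` and height at most the
number `n` of vertices. A potential shows that this stops after polynomially many steps
(`potential_step_lt`). If at the end some edge has a tail of out-degree at least `k`, this tail has
height `n + 1`, so some level between `1` and `n` is empty; no edge leads from the vertices above
that level to those below it, and all vertices above it have out-degree at least `k - 1`, hence every
orientation has a vertex of out-degree at least `k` (`exists_le_card_of_stuck`). The local star
arboricity is the number of all `k < n` for which the algorithm ends with such a tail
(`algorithm_encodeGraph`).

*Polynomial time.* All data are binary trees, written in prefix notation on a stack. The predicate
`PolyTime` says that a function on such data is computed by a program on five stacks in polynomial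
time. It is closed under composition, pairing, case distinction, and folds all of whose intermediate
values have polynomial size (`PolyTime.foldl_of_size_le`); these closure properties suffice for the
algorithm (`polyTime_algorithm`). The programs have finitely many lists of pending commands. With
these as labels they become Turing machines that make one step per command, and the tree encoding is
adapted to the prescribed input and output strings (`PolyTime.nonempty_tm2`).
-/


/-! ### Stack programs -/

namespace StackProgram

open Function

/-- Programs over finitely many stacks; stack `k` holds letters of `Γ k`. The command
`loop k last f` pops a letter from stack `k` (`none` if the stack is empty), runs the program that
`f` assigns to it, and starts again unless `last` holds for the popped letter. -/
inductive Cmd (K : Type) (Γ : K → Type) : Type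
  | skip : Cmd K Γ
  | push (k : K) (a : Γ k) : Cmd K Γ
  | seq (c d : Cmd K Γ) : Cmd K Γ
  | loop (k : K) (last : Option (Γ k) → Bool) (f : Option (Γ k) → Cmd K Γ) : Cmd K Γ

variable {K : Type} {Γ : K → Type}

namespace Cmd

/-- All lists of pending commands that occur while `c` is run with the commands `r` pending after
it, apart from `r` itself. These are the labels of the compiled machine. -/
def conts : Cmd K Γ → List (Cmd K Γ) → Set (List (Cmd K Γ))
  | skip, r => {skip :: r}
  | push k a, r => {push k a :: r}
  | seq c d, r => insert (seq c d :: r) (conts c (d :: r) ∪ conts d r)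
  | loop k last f, r =>
      insert (loop k last f :: r) (⋃ o, (conts (f o) r ∪ conts (f o) (loop k last f :: r)))

theorem conts_finite [∀ k, Finite (Γ k)] (c : Cmd K Γ) (r : List (Cmd K Γ)) :
    (conts c r).Finite := by
  induction c generalizing r with
  | skip => exact Set.finite_singleton _
  | push => exact Set.finite_singleton _
  | seq c d hc hd => exact ((hc _).union (hd _)).insert _
  | loop k last f hf => exact (Set.finite_iUnion fun o => (hf o _).union (hf o _)).insert _

theorem cons_mem_conts (c : Cmd K Γ) (r : List (Cmd K Γ)) : c :: r ∈ conts c r := by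
  cases c <;> simp [conts]

/-- The list of pending commands after one step, depending on the stacks. -/
def nextCmds : List (Cmd K Γ) → (∀ k, List (Γ k)) → List (Cmd K Γ)
  | [], _ => []
  | skip :: r, _ => r
  | push _ _ :: r, _ => r
  | seq c d :: r, _ => c :: d :: r
  | loop k last f :: r, S =>
      f (S k).head? :: if last (S k).head? then r else loop k last f :: r

theorem nextCmds_mem_conts (c : Cmd K Γ) (r l : List (Cmd K Γ)) (S : ∀ k, List (Γ k))
    (hl : l ∈ conts c r) : nextCmds l S ∈ insert r (conts c r) := by
  induction c generalizing r with
  | skip =>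
    obtain rfl : l = _ := hl
    exact Or.inl rfl
  | push =>
    obtain rfl : l = _ := hl
    exact Or.inl rfl
  | seq c d hc hd =>
    rcases hl with rfl | hl | hl
    · exact Or.inr (Or.inr (Or.inl (cons_mem_conts _ _)))
    · rcases hc _ hl with h | h
      · rw [h]
        exact Or.inr (Or.inr (Or.inr (cons_mem_conts _ _)))
      · exact Or.inr (Or.inr (Or.inl h))
    · rcases hd _ hl with h | h
      · exact Or.inl h
      · exact Or.inr (Or.inr (Or.inr h))
  | loop k last f hf =>
    rcases hl with rfl | hl
    · refine Or.inr (Or.inr (Set.mem_iUnion.2 ⟨(S k).head?, ?_⟩))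
      by_cases h : last (S k).head?
      · simp only [nextCmds, h, if_true]
        exact Or.inl (cons_mem_conts _ _)
      · simp only [nextCmds, h]
        exact Or.inr (cons_mem_conts _ _)
    · obtain ⟨o, hl | hl⟩ := Set.mem_iUnion.1 hl
      · rcases hf o _ hl with h | h
        · exact Or.inl h
        · exact Or.inr (Or.inr (Set.mem_iUnion.2 ⟨o, Or.inl h⟩))
      · rcases hf o _ hl with h | h
        · rw [h]
          exact Or.inr (Or.inl rfl)
        · exact Or.inr (Or.inr (Set.mem_iUnion.2 ⟨o, Or.inr h⟩))

/-- The labels of the machine compiled from `c`. -/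
abbrev Label (c : Cmd K Γ) : Type := ↥(insert [] (conts c []))

theorem nextCmds_mem_label (c : Cmd K Γ) (l : Label c) (S : ∀ k, List (Γ k)) :
    nextCmds l.1 S ∈ insert [] (conts c []) := by
  obtain ⟨l, rfl | hl⟩ := l
  · exact Or.inl rfl
  · exact nextCmds_mem_conts c [] l S hl

open Classical in
/-- A list of commands as a label; lists that are no labels do not occur. -/
noncomputable def toLabel (c : Cmd K Γ) (l : List (Cmd K Γ)) : Label c :=
  if h : l ∈ insert [] (conts c []) then ⟨l, h⟩ else ⟨[], Or.inl rfl⟩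

theorem coe_toLabel {c : Cmd K Γ} {l : List (Cmd K Γ)} (h : l ∈ insert [] (conts c [])) :
    (toLabel c l).1 = l := by
  rw [toLabel, dif_pos h]

variable [DecidableEq K]

/-- The stacks after one step. -/
def nextStacks : List (Cmd K Γ) → (∀ k, List (Γ k)) → ∀ k, List (Γ k)
  | push k a :: _, S => update S k (a :: S k)
  | loop k _ _ :: _, S => update S k (S k).tail
  | _, S => S

/-- One step of a program, given by the list of pending commands and the stacks. -/
def next (x : List (Cmd K Γ) × (∀ k, List (Γ k))) : List (Cmd K Γ) × (∀ k, List (Γ k)) :=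
  (nextCmds x.1 x.2, nextStacks x.1 x.2)

/-- `Runs c S S' t`: started with the stacks `S`, the program `c` ends with the stacks `S'` after
at most `t` steps, whatever commands are pending after it. -/
def Runs (c : Cmd K Γ) (S S' : ∀ k, List (Γ k)) (t : ℕ) : Prop :=
  ∃ s ≤ t, ∀ r, next^[s] (c :: r, S) = (r, S')

theorem Runs.mono {c : Cmd K Γ} {S S' : ∀ k, List (Γ k)} {t t' : ℕ} (h : Runs c S S' t)
    (ht : t ≤ t') : Runs c S S' t' :=
  let ⟨s, hs, h⟩ := h
  ⟨s, hs.trans ht, h⟩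

theorem runs_skip (S : ∀ k, List (Γ k)) : Runs skip S S 1 := ⟨1, le_rfl, fun _ => rfl⟩

theorem runs_push (k : K) (a : Γ k) (S : ∀ k, List (Γ k)) :
    Runs (push k a) S (update S k (a :: S k)) 1 := ⟨1, le_rfl, fun _ => rfl⟩

theorem Runs.seq {c d : Cmd K Γ} {S S' S'' : ∀ k, List (Γ k)} {t t' : ℕ} (hc : Runs c S S' t)
    (hd : Runs d S' S'' t') : Runs (seq c d) S S'' (t + t' + 1) := by
  obtain ⟨s, hs, hc⟩ := hc
  obtain ⟨s', hs', hd⟩ := hd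
  refine ⟨s' + (s + 1), by omega, fun r => ?_⟩
  rw [iterate_add_apply, iterate_add_apply]
  change next^[s'] (next^[s] (c :: d :: r, S)) = _
  rw [hc, hd]

theorem runs_loop_last {k : K} {last : Option (Γ k) → Bool} {f : Option (Γ k) → Cmd K Γ}
    {S S' : ∀ k, List (Γ k)} {t : ℕ} (h : last (S k).head? = true)
    (hf : Runs (f (S k).head?) (update S k (S k).tail) S' t) :
    Runs (loop k last f) S S' (t + 1) := by
  obtain ⟨s, hs, hf⟩ := hf
  refine ⟨s + 1, by omega, fun r => ?_⟩
  rw [iterate_add_apply]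
  simp only [iterate_one, next, nextCmds, nextStacks, h, if_true, hf]

theorem runs_loop_next {k : K} {last : Option (Γ k) → Bool} {f : Option (Γ k) → Cmd K Γ}
    {S S' S'' : ∀ k, List (Γ k)} {t t' : ℕ} (h : last (S k).head? = false)
    (hf : Runs (f (S k).head?) (update S k (S k).tail) S' t)
    (hl : Runs (loop k last f) S' S'' t') :
    Runs (loop k last f) S S'' (t + t' + 1) := by
  obtain ⟨s, hs, hf⟩ := hf
  obtain ⟨s', hs', hl⟩ := hl
  refine ⟨s' + (s + 1), by omega, fun r => ?_⟩
  rw [iterate_add_apply, iterate_add_apply]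
  simp only [iterate_one, next, nextCmds, nextStacks, h]
  simp [hf, hl]

/-! ### Compilation to Turing machines -/

/-- The statement of the compiled machine at a list of pending commands. The internal state
remembers, for every stack, the letter that was popped last, and it is reset before halting. -/
noncomputable def stmt (c : Cmd K Γ) :
    List (Cmd K Γ) → Turing.TM2.Stmt Γ (Label c) (∀ k, Option (Γ k))
  | [] => .load (fun _ _ => none) .halt
  | skip :: r => .goto fun _ => toLabel c r
  | push k a :: r => .push k (fun _ => a) (.goto fun _ => toLabel c r)
  | seq d e :: r => .goto fun _ => toLabel c (d :: e :: r)
  | loop k last f :: r => .pop k (fun v o => update v k o) (.goto fun v =>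
      toLabel c (f (v k) :: if last (v k) then r else loop k last f :: r))

theorem step_stmt (c : Cmd K Γ) (l : Label c) (hl : l.1 ≠ [])
    (v : ∀ k, Option (Γ k)) (S : ∀ k, List (Γ k)) :
    ∃ v', Turing.TM2.step (fun l : Label c => stmt c l.1) ⟨some l, v, S⟩ =
      some ⟨some (toLabel c (nextCmds l.1 S)), v', nextStacks l.1 S⟩ := by
  obtain ⟨l, h⟩ := l
  match l, h, hl with
  | skip :: r, _, _ => exact ⟨_, rfl⟩
  | push k a :: r, _, _ => exact ⟨_, rfl⟩
  | seq d e :: r, _, _ => exact ⟨_, rfl⟩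
  | loop k last f :: r, _, _ =>
    refine ⟨update v k (S k).head?, ?_⟩
    simp [stmt, nextCmds, nextStacks]

theorem iterate_step_stmt (c : Cmd K Γ) {t : ℕ} {S S' : ∀ k, List (Γ k)}
    (l : Label c) (h : next^[t] (l.1, S) = ([], S')) (v : ∀ k, Option (Γ k)) :
    ∃ s ≤ t + 1, (flip bind (Turing.TM2.step (fun l : Label c => stmt c l.1)))^[s]
      (some ⟨some l, v, S⟩) = some ⟨none, fun _ => none, S'⟩ := by
  have key : ∀ (l : Label c) (v : ∀ k, Option (Γ k)) (S : ∀ k, List (Γ k)), l.1 = [] →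
      (flip bind (Turing.TM2.step (fun l : Label c => stmt c l.1)))^[1] (some ⟨some l, v, S⟩) =
        some ⟨none, fun _ => none, S⟩ := by
    rintro ⟨l, h⟩ v S rfl
    rfl
  induction t generalizing l v S with
  | zero =>
    simp only [iterate_zero, id_eq, Prod.mk.injEq] at h
    exact ⟨1, le_rfl, by rw [key l v S h.1, h.2]⟩
  | succ t ih =>
    by_cases hl : l.1 = []
    · have : next^[t + 1] (l.1, S) = ([], S) := by
        rw [hl]
        exact iterate_fixed rfl _
      rw [this, Prod.mk.injEq] at h
      exact ⟨1, by omega, by rw [key l v S hl, h.2]⟩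
    · obtain ⟨v', hv⟩ := step_stmt c l hl v S
      rw [iterate_succ_apply] at h
      obtain ⟨s, hs, h'⟩ := ih (toLabel c (nextCmds l.1 S)) (S := nextStacks l.1 S)
        (by rw [coe_toLabel (nextCmds_mem_label c l S)]; exact h) v'
      refine ⟨s + 1, by omega, ?_⟩
      rw [iterate_succ_apply, ← h', ← hv]
      rfl

variable [Fintype K] [∀ k, Fintype (Γ k)]

/-- The Turing machine compiled from the program `c`. -/
noncomputable def machine (c : Cmd K Γ) (k₀ k₁ : K) : Turing.FinTM2 :=
  haveI : Finite (Label c) := ((conts_finite c []).insert []).to_subtype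
  { K := K
    k₀ := k₀
    k₁ := k₁
    Γ := Γ
    Λ := Label c
    ΛFin := Fintype.ofFinite _
    main := toLabel c [c]
    σ := ∀ k, Option (Γ k)
    initialState := fun _ => none
    m := fun l => stmt c l.1 }

/-- The compiled machine takes at most one step more than the program. -/
theorem Runs.exists_iterate_step {c : Cmd K Γ} {S S' : ∀ k, List (Γ k)} {t : ℕ}
    (h : Runs c S S' t) (k₀ k₁ : K) :
    ∃ s ≤ t + 1, (flip bind (machine c k₀ k₁).step)^[s]
        (some ⟨some (toLabel c [c]), fun _ => none, S⟩) = some ⟨none, fun _ => none, S'⟩ := by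
  obtain ⟨s, hs, h⟩ := h
  obtain ⟨s', hs', h'⟩ := iterate_step_stmt c (toLabel c [c])
    (by rw [coe_toLabel (Or.inr (cons_mem_conts c []))]; exact h []) (fun _ => none)
  exact ⟨s', by omega, h'⟩

end Cmd

end StackProgram

namespace StackProgram

open Function Cmd

/-! ### Trees on a stack -/

/-- The stacks of the programs below: `main` holds the data, `aux`, `tmp` and `cnt` are used
temporarily, and `out` receives the output. -/
inductive Stack
  | main | aux | tmp | cnt | out
  deriving DecidableEq

instance : Fintype Stack := ⟨{.main, .aux, .tmp, .cnt, .out}, fun k => by cases k <;> simp⟩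

/-- The stack alphabets. On the stacks other than `out` the letters `some b` make up the words that
represent trees, and `none` serves as a bottom marker. -/
abbrev Letter : Stack → Type
  | .out => Bool
  | _ => Option Bool

instance : ∀ k, Fintype (Letter k)
  | .out => inferInstanceAs (Fintype Bool)
  | .main => inferInstanceAs (Fintype (Option Bool))
  | .aux => inferInstanceAs (Fintype (Option Bool))
  | .tmp => inferInstanceAs (Fintype (Option Bool))
  | .cnt => inferInstanceAs (Fintype (Option Bool))

/-- Programs over the stacks `main`, `aux`, `tmp`, `cnt` and `out`. -/
abbrev Prog : Type := Cmd Stack Letter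

/-- The stacks with the given contents. -/
def st (m a b c : List (Option Bool)) (o : List Bool) : ∀ k, List (Letter k)
  | .main => m
  | .aux => a
  | .tmp => b
  | .cnt => c
  | .out => o

section st

variable (m a b c x : List (Option Bool)) (o y : List Bool)

theorem update_main : update (st m a b c o) .main x = st x a b c o := by
  funext k; cases k <;> rfl
theorem update_aux : update (st m a b c o) .aux x = st m x b c o := by
  funext k; cases k <;> rfl
theorem update_tmp : update (st m a b c o) .tmp x = st m a x c o := by
  funext k; cases k <;> rfl
theorem update_cnt : update (st m a b c o) .cnt x = st m a b x o := by
  funext k; cases k <;> rfl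
theorem update_out : update (st m a b c o) .out y = st m a b c y := by
  funext k; cases k <;> rfl

variable (l : Option Bool) (u : Bool)

theorem runs_push_main : Runs (push .main l : Prog) (st m a b c o) (st (l :: m) a b c o) 1 := by
  convert runs_push (Γ := Letter) .main l (st m a b c o) using 1
  exact (update_main ..).symm
theorem runs_push_aux : Runs (push .aux l : Prog) (st m a b c o) (st m (l :: a) b c o) 1 := by
  convert runs_push (Γ := Letter) .aux l (st m a b c o) using 1
  exact (update_aux ..).symm
theorem runs_push_tmp : Runs (push .tmp l : Prog) (st m a b c o) (st m a (l :: b) c o) 1 := by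
  convert runs_push (Γ := Letter) .tmp l (st m a b c o) using 1
  exact (update_tmp ..).symm
theorem runs_push_cnt : Runs (push .cnt l : Prog) (st m a b c o) (st m a b (l :: c) o) 1 := by
  convert runs_push (Γ := Letter) .cnt l (st m a b c o) using 1
  exact (update_cnt ..).symm
theorem runs_push_out : Runs (push .out u : Prog) (st m a b c o) (st m a b c (u :: o)) 1 := by
  convert runs_push (Γ := Letter) .out u (st m a b c o) using 1
  exact (update_out ..).symm

variable {m a b c o l} {last : Option (Option Bool) → Bool} {f : Option (Option Bool) → Prog}
  {S S' : ∀ k, List (Letter k)} {n n' : ℕ}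

theorem runs_loop_main_last (h : last (some l) = true)
    (hf : Runs (f (some l)) (st m a b c o) S n) :
    Runs (loop .main last f : Prog) (st (l :: m) a b c o) S (n + 1) := by
  refine runs_loop_last h ?_
  change Runs (f (some l)) _ _ _
  convert hf using 1
  exact update_main (l :: m) a b c _ o
theorem runs_loop_main_next (h : last (some l) = false)
    (hf : Runs (f (some l)) (st m a b c o) S n) (hl : Runs (loop .main last f : Prog) S S' n') :
    Runs (loop .main last f : Prog) (st (l :: m) a b c o) S' (n + n' + 1) := by
  refine runs_loop_next h ?_ hl
  change Runs (f (some l)) _ _ _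
  convert hf using 1
  exact update_main (l :: m) a b c _ o
theorem runs_loop_aux_last (h : last (some l) = true)
    (hf : Runs (f (some l)) (st m a b c o) S n) :
    Runs (loop .aux last f : Prog) (st m (l :: a) b c o) S (n + 1) := by
  refine runs_loop_last h ?_
  change Runs (f (some l)) _ _ _
  convert hf using 1
  exact update_aux m (l :: a) b c _ o
theorem runs_loop_aux_next (h : last (some l) = false)
    (hf : Runs (f (some l)) (st m a b c o) S n) (hl : Runs (loop .aux last f : Prog) S S' n') :
    Runs (loop .aux last f : Prog) (st m (l :: a) b c o) S' (n + n' + 1) := by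
  refine runs_loop_next h ?_ hl
  change Runs (f (some l)) _ _ _
  convert hf using 1
  exact update_aux m (l :: a) b c _ o
theorem runs_loop_tmp_last (h : last (some l) = true)
    (hf : Runs (f (some l)) (st m a b c o) S n) :
    Runs (loop .tmp last f : Prog) (st m a (l :: b) c o) S (n + 1) := by
  refine runs_loop_last h ?_
  change Runs (f (some l)) _ _ _
  convert hf using 1
  exact update_tmp m a (l :: b) c _ o
theorem runs_loop_tmp_next (h : last (some l) = false)
    (hf : Runs (f (some l)) (st m a b c o) S n) (hl : Runs (loop .tmp last f : Prog) S S' n') :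
    Runs (loop .tmp last f : Prog) (st m a (l :: b) c o) S' (n + n' + 1) := by
  refine runs_loop_next h ?_ hl
  change Runs (f (some l)) _ _ _
  convert hf using 1
  exact update_tmp m a (l :: b) c _ o
theorem runs_loop_cnt_last (h : last (some l) = true)
    (hf : Runs (f (some l)) (st m a b c o) S n) :
    Runs (loop .cnt last f : Prog) (st m a b (l :: c) o) S (n + 1) := by
  refine runs_loop_last h ?_
  change Runs (f (some l)) _ _ _
  convert hf using 1
  exact update_cnt m a b (l :: c) _ o
theorem runs_loop_cnt_next (h : last (some l) = false)
    (hf : Runs (f (some l)) (st m a b c o) S n) (hl : Runs (loop .cnt last f : Prog) S S' n') :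
    Runs (loop .cnt last f : Prog) (st m a b (l :: c) o) S' (n + n' + 1) := by
  refine runs_loop_next h ?_ hl
  change Runs (f (some l)) _ _ _
  convert hf using 1
  exact update_cnt m a b (l :: c) _ o

end st

/-- Binary trees, the data on which the programs operate. -/
inductive Tree
  | leaf : Tree
  | node (s t : Tree) : Tree

/-- The word that represents a tree, in prefix notation. -/
def Tree.code : Tree → List Bool
  | leaf => [false]
  | node s t => true :: (s.code ++ t.code)

/-- The word that represents a tree, as letters of a stack. -/
abbrev Tree.letters (t : Tree) : List (Option Bool) := t.code.map some

/-- Pop a letter from `main` and run the program assigned to it. -/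
def popMain (f : Option (Option Bool) → Prog) : Prog := loop .main (fun _ => true) f

theorem runs_popMain {f : Option (Option Bool) → Prog} {l : Option Bool}
    {m a b c : List (Option Bool)} {o : List Bool} {S : ∀ k, List (Letter k)} {n : ℕ}
    (h : Runs (f (some l)) (st m a b c o) S n) :
    Runs (popMain f) (st (l :: m) a b c o) S (n + 1) :=
  runs_loop_main_last rfl h

/-- Move the letters above the topmost marker of `aux` to `main`, and remove the marker. -/
def unstash : Prog :=
  loop .aux (fun o : Option (Option Bool) => o.join.isNone) fun o : Option (Option Bool) =>
    match o with
    | some (some x) => push .main (some x)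
    | _ => skip

theorem runs_unstash (w : List Bool) (m a b c : List (Option Bool)) (o : List Bool) :
    Runs unstash (st m (w.map some ++ none :: a) b c o) (st ((w.map some).reverse ++ m) a b c o)
      (2 * w.length + 2) := by
  induction w generalizing m with
  | nil => exact runs_loop_aux_last rfl (runs_skip _)
  | cons x w ih =>
    simp only [List.map_cons, List.reverse_cons, List.append_assoc]
    exact (runs_loop_aux_next rfl (runs_push_main ..) (ih _)).mono (by simp; omega)

/-- Remove the letters of `aux` down to and including the topmost marker. -/
def discard : Prog :=
  loop .aux (fun o : Option (Option Bool) => o.join.isNone) fun _ => skip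

theorem runs_discard (w : List Bool) (m a b c : List (Option Bool)) (o : List Bool) :
    Runs discard (st m (w.map some ++ none :: a) b c o) (st m a b c o) (2 * w.length + 2) := by
  induction w with
  | nil => exact runs_loop_aux_last rfl (runs_skip _)
  | cons x w ih => exact (runs_loop_aux_next rfl (runs_skip _) ih).mono (by simp; omega)

/-- Move the letters above the topmost marker of `aux` to `main` and, in the same order, to `tmp`,
and remove the marker. -/
def unstashTwice : Prog :=
  loop .aux (fun o : Option (Option Bool) => o.join.isNone) fun o : Option (Option Bool) =>
    match o with
    | some (some x) => seq (push .main (some x)) (push .tmp (some x))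
    | _ => skip

theorem runs_unstashTwice (w : List Bool) (m a b c : List (Option Bool)) (o : List Bool) :
    Runs unstashTwice (st m (w.map some ++ none :: a) b c o)
      (st ((w.map some).reverse ++ m) a ((w.map some).reverse ++ b) c o) (4 * w.length + 2) := by
  induction w generalizing m b with
  | nil => exact runs_loop_aux_last rfl (runs_skip _)
  | cons x w ih =>
    simp only [List.map_cons, List.reverse_cons, List.append_assoc]
    exact (runs_loop_aux_next rfl ((runs_push_main ..).seq (runs_push_tmp ..)) (ih _ _)).mono
      (by simp; omega)

/-- Move the letters above the topmost marker of `tmp` to `aux`, and remove the marker. -/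
def tmpToAux : Prog :=
  loop .tmp (fun o : Option (Option Bool) => o.join.isNone) fun o : Option (Option Bool) =>
    match o with
    | some (some x) => push .aux (some x)
    | _ => skip

theorem runs_tmpToAux (w : List Bool) (m a b c : List (Option Bool)) (o : List Bool) :
    Runs tmpToAux (st m a (w.map some ++ none :: b) c o) (st m ((w.map some).reverse ++ a) b c o)
      (2 * w.length + 2) := by
  induction w generalizing a with
  | nil => exact runs_loop_tmp_last rfl (runs_skip _)
  | cons x w ih =>
    simp only [List.map_cons, List.reverse_cons, List.append_assoc]
    exact (runs_loop_tmp_next rfl (runs_push_aux ..) (ih _)).mono (by simp; omega)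

/-- Move as many trees from `main` to `aux` as there are letters `some true` on top of `cnt`. -/
def stashLoop : Prog :=
  loop .cnt (fun o : Option (Option Bool) => o.join.isNone) fun o : Option (Option Bool) =>
    match o with
    | some (some _) =>
      loop .main (fun _ => true) fun o : Option (Option Bool) =>
        match o with
        | some (some true) =>
          seq (push .aux (some true)) (seq (push .cnt (some true)) (push .cnt (some true)))
        | _ => push .aux (some false)
    | _ => skip

theorem runs_stashLoop (t : Tree) {m a b c : List (Option Bool)} {o : List Bool}
    {S : ∀ k, List (Letter k)} {n : ℕ}
    (h : Runs stashLoop (st m (t.letters.reverse ++ a) b c o) S n) :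
    Runs stashLoop (st (t.letters ++ m) a b (some true :: c) o) S (n + 8 * t.code.length) := by
  induction t generalizing m a c n with
  | leaf =>
    exact (runs_loop_cnt_next rfl (runs_loop_main_last rfl (runs_push_aux ..)) h).mono
      (by simp [Tree.code]; omega)
  | node s t hs ht =>
    have hst : Runs stashLoop (st (s.letters ++ (t.letters ++ m)) (some true :: a) b
        (some true :: some true :: c) o) S (n + 8 * t.code.length + 8 * s.code.length) :=
      hs (ht (by simpa [Tree.letters, Tree.code] using h))
    rw [← List.append_assoc, ← List.map_append] at hst
    exact (runs_loop_cnt_next rfl (runs_loop_main_last rfl ((runs_push_aux ..).seq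
      ((runs_push_cnt ..).seq (runs_push_cnt ..)))) hst).mono
      (t := 6 + (n + 8 * t.code.length + 8 * s.code.length) + 1) (by simp [Tree.code]; omega)

/-- Move a tree from `main` to `aux`, reversed and above a marker. -/
def stash : Prog :=
  seq (push .aux none) (seq (push .cnt none) (seq (push .cnt (some true)) stashLoop))

theorem runs_stash (t : Tree) (m a b c : List (Option Bool)) (o : List Bool) :
    Runs stash (st (t.letters ++ m) a b c o) (st m (t.letters.reverse ++ none :: a) b c o)
      (8 * t.code.length + 8) :=
  ((runs_push_aux ..).seq ((runs_push_cnt ..).seq ((runs_push_cnt ..).seq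
    (runs_stashLoop t (runs_loop_cnt_last (l := none) rfl (runs_skip _)))))).mono (by omega)

theorem runs_unstash_tree (t : Tree) (m a b c : List (Option Bool)) (o : List Bool) :
    Runs unstash (st m (t.letters.reverse ++ none :: a) b c o) (st (t.letters ++ m) a b c o)
      (2 * t.code.length + 2) := by
  simpa using runs_unstash t.code.reverse m a b c o

/-- Remove a tree from `main`. -/
def drop : Prog := seq stash discard

theorem runs_drop (t : Tree) (m a b c : List (Option Bool)) (o : List Bool) :
    Runs drop (st (t.letters ++ m) a b c o) (st m a b c o) (10 * t.code.length + 11) := by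
  have := runs_discard t.code.reverse m a b c o
  rw [List.map_reverse] at this
  exact ((runs_stash t ..).seq this).mono (by simp; omega)

/-- Duplicate a tree on `main`. -/
def dup : Prog :=
  seq stash (seq (push .tmp none) (seq unstashTwice (seq (push .aux none) (seq tmpToAux unstash))))

theorem runs_dup (t : Tree) (m a b c : List (Option Bool)) (o : List Bool) :
    Runs dup (st (t.letters ++ m) a b c o) (st (t.letters ++ (t.letters ++ m)) a b c o)
      (16 * t.code.length + 21) := by
  have h := runs_unstashTwice t.code.reverse m a (none :: b) c o
  simp only [List.map_reverse, List.reverse_reverse] at h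
  exact ((runs_stash t ..).seq ((runs_push_tmp ..).seq (h.seq ((runs_push_aux ..).seq
    ((runs_tmpToAux ..).seq (runs_unstash_tree t ..)))))).mono (by simp; omega)

end StackProgram

namespace StackProgram

open Function Cmd

/-! ### Polynomial-time functions on tree-encoded data -/

/-- Types whose elements are represented by trees. -/
class ToTree (α : Type) where
  /-- the tree that represents an element -/
  toTree : α → Tree

export ToTree (toTree)

instance : ToTree Unit := ⟨fun _ => .leaf⟩

instance : ToTree Bool := ⟨fun b => if b then .node .leaf .leaf else .leaf⟩

/-- Natural numbers are represented in unary. -/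
instance : ToTree ℕ := ⟨Nat.rec .leaf fun _ t => .node .leaf t⟩

instance {α β : Type} [ToTree α] [ToTree β] : ToTree (α × β) :=
  ⟨fun x => .node (toTree x.1) (toTree x.2)⟩

instance {α : Type} [ToTree α] : ToTree (List α) :=
  ⟨fun l => l.foldr (fun a t => .node (toTree a) t) .leaf⟩

variable {α β γ σ : Type} [ToTree α] [ToTree β] [ToTree γ] [ToTree σ]

/-- The length of the word that represents `x`. -/
def size (x : α) : ℕ := (toTree x).code.length

/-- The letters of the word that represents `x`. -/
abbrev word (x : α) : List (Option Bool) := (toTree x).letters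

@[simp] theorem size_unit (u : Unit) : size u = 1 := rfl
@[simp] theorem size_pair (x : α) (y : β) : size (x, y) = size x + size y + 1 := by
  simp [size, toTree, Tree.code]
@[simp] theorem size_nil : size ([] : List α) = 1 := rfl
@[simp] theorem size_cons (x : α) (l : List α) : size (x :: l) = size x + size l + 1 := by
  simp [size, toTree, Tree.code]
@[simp] theorem size_nat (n : ℕ) : size n = 2 * n + 1 := by
  induction n with
  | zero => rfl
  | succ n ih =>
    have : size (n + 1) = size n + 2 := by
      simp [size, toTree, Tree.code]
    omega
theorem size_bool_le (b : Bool) : size b ≤ 3 := by cases b <;> decide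
theorem size_pos (x : α) : 0 < size x := by
  unfold size; cases toTree x <;> simp [Tree.code]
theorem size_append (l l' : List α) : size (l ++ l') + 1 = size l + size l' := by
  induction l with
  | nil => simp; omega
  | cons a l ih => simp; omega
theorem length_le_size (l : List α) : l.length ≤ size l := by
  induction l with
  | nil => simp
  | cons a l ih => simp; omega
theorem size_le_of_mem {l : List α} {a : α} (h : a ∈ l) : size a ≤ size l := by
  induction l with
  | nil => simp at h
  | cons b l ih =>
    rcases List.mem_cons.1 h with rfl | h
    · simp; omega
    · have := ih h
      simp; omega

theorem word_pair (x : α) (y : β) : word (x, y) = some true :: (word x ++ word y) := by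
  simp [word, Tree.letters, toTree, Tree.code]
theorem word_cons (x : α) (l : List α) : word (x :: l) = some true :: (word x ++ word l) := by
  simp [word, Tree.letters, toTree, Tree.code]
theorem word_nil : word ([] : List α) = [some false] := rfl

theorem eval_mono (p : Polynomial ℕ) : Monotone fun n => p.eval n := by
  intro a b hab
  induction p using Polynomial.induction_on' with
  | add p q hp hq => simpa using add_le_add hp hq
  | monomial n c => simpa using Nat.mul_le_mul_left c (Nat.pow_le_pow_left hab n)

/-- The program `c` computes `y` from `x` in at most `n` steps: it replaces the word of `x` on top
of `main` by the word of `y`, and leaves all that is below it and the other stacks as they are. -/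
def Computes (c : Prog) (x : α) (y : β) (n : ℕ) : Prop :=
  ∀ m a b d o, Runs c (st (word x ++ m) a b d o) (st (word y ++ m) a b d o) n

/-- Functions computed by a program in polynomial time. The bound on the size of the value is part
of the definition for convenience only. -/
@[fun_prop]
def PolyTime (f : α → β) : Prop :=
  ∃ (c : Prog) (p : Polynomial ℕ), ∀ x, Computes c x (f x) (p.eval (size x)) ∧
    size (f x) ≤ p.eval (size x)

namespace PolyTime

theorem size_le {f : α → β} (hf : PolyTime f) :
    ∃ p : Polynomial ℕ, ∀ x, size (f x) ≤ p.eval (size x) :=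
  let ⟨_, p, h⟩ := hf
  ⟨p, fun x => (h x).2⟩

/-- Polynomial-time computability depends only on the trees that represent arguments and values. -/
theorem of_toTree_eq {f : α → β} (hf : PolyTime f) {e : γ → α} {g : γ → σ}
    (he : ∀ x, toTree (e x) = toTree x) (h : ∀ x, toTree (g x) = toTree (f (e x))) :
    PolyTime g := by
  obtain ⟨c, p, hc⟩ := hf
  refine ⟨c, p, fun x => ?_⟩
  have := hc (e x)
  simp only [Computes, word, size, he, ← h] at this
  exact this

@[fun_prop]
theorem id : PolyTime (fun x : α => x) :=
  ⟨skip, .X + 1, fun x => ⟨fun m a b d o => (runs_skip _).mono (by simp), by simp⟩⟩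

@[fun_prop]
theorem comp {g : β → γ} {f : α → β} (hg : PolyTime g) (hf : PolyTime f) :
    PolyTime (fun x => g (f x)) := by
  obtain ⟨c, p, hc⟩ := hf
  obtain ⟨d, q, hd⟩ := hg
  refine ⟨seq c d, p + q.comp p + 1, fun x => ?_⟩
  have h := eval_mono q (hc x).2
  simp only [Polynomial.eval_add, Polynomial.eval_comp, Polynomial.eval_one] at h ⊢
  exact ⟨fun m a b e o => (((hc x).1 m a b e o).seq ((hd (f x)).1 m a b e o)).mono (by omega),
    by have := (hd (f x)).2; omega⟩

/-- Push the letters of `w` to `main` so that the first one is on top. -/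
def pushWord : List Bool → Prog
  | [] => skip
  | x :: w => seq (pushWord w) (push .main (some x))

theorem runs_pushWord (w : List Bool) (m a b c : List (Option Bool)) (o : List Bool) :
    Runs (pushWord w) (st m a b c o) (st (w.map some ++ m) a b c o) (2 * w.length + 1) := by
  induction w with
  | nil => exact runs_skip _
  | cons x w ih => exact (ih.seq (runs_push_main ..)).mono (by simp; omega)

@[fun_prop]
theorem const (y : β) : PolyTime (fun _ : α => y) := by
  refine ⟨seq drop (pushWord (toTree y).code), 10 * .X + 13 + 2 * (size y : Polynomial ℕ),
    fun x => ⟨fun m a b d o => ?_, ?_⟩⟩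
  · refine ((runs_drop (toTree x) ..).seq (runs_pushWord ..)).mono ?_
    simp [size]
    omega
  · simp
    omega

@[fun_prop]
theorem prodMk {f : α → β} {g : α → γ} (hf : PolyTime f) (hg : PolyTime g) :
    PolyTime (fun x => (f x, g x)) := by
  obtain ⟨c, p, hc⟩ := hf
  obtain ⟨d, q, hd⟩ := hg
  -- Compute `f x` from the upper copy of `x`, keep it on `aux` while `g x` is computed from the
  -- lower copy, and join both by the letter of a node.
  refine ⟨seq dup (seq c (seq stash (seq d (seq unstash (push .main (some true)))))),
    16 * .X + 11 * p + q + 40, fun x => ⟨fun m a b e o => ?_, ?_⟩⟩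
  · rw [word_pair, List.cons_append, List.append_assoc]
    refine ((runs_dup (toTree x) m a b e o).seq (((hc x).1 _ a b e o).seq
      ((runs_stash (toTree (f x)) _ a b e o).seq (((hd x).1 m _ b e o).seq
      ((runs_unstash_tree (toTree (f x)) _ a b e o).seq (runs_push_main ..)))))).mono ?_
    have := (hc x).2
    simp [size] at this ⊢
    omega
  · have := (hc x).2
    have := (hd x).2
    simp
    omega

@[fun_prop]
theorem fst {f : α → β × γ} (hf : PolyTime f) : PolyTime (fun x => (f x).1) := by
  refine comp (g := Prod.fst) ?_ hf
  refine ⟨popMain fun _ => seq stash (seq drop unstash), 20 * .X + 40, ?_⟩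
  rintro ⟨x, y⟩
  refine ⟨fun m a b d o => ?_, by simp; omega⟩
  rw [word_pair, List.cons_append, List.append_assoc]
  refine (runs_popMain ((runs_stash (toTree x) ..).seq ((runs_drop (toTree y) ..).seq
    (runs_unstash_tree (toTree x) ..)))).mono ?_
  rw [size_pair]
  simp [size]
  omega

@[fun_prop]
theorem snd {f : α → β × γ} (hf : PolyTime f) : PolyTime (fun x => (f x).2) := by
  refine comp (g := Prod.snd) ?_ hf
  refine ⟨popMain fun _ => drop, 20 * .X + 40, ?_⟩
  rintro ⟨x, y⟩
  refine ⟨fun m a b d o => ?_, by simp; omega⟩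
  rw [word_pair, List.cons_append, List.append_assoc]
  refine (runs_popMain (runs_drop (toTree x) ..)).mono ?_
  rw [size_pair]
  simp [size]
  omega

@[fun_prop]
theorem cons {f : α → β} {g : α → List β} (hf : PolyTime f) (hg : PolyTime g) :
    PolyTime (fun x => f x :: g x) :=
  (prodMk hf hg).of_toTree_eq (e := _root_.id) (fun _ => rfl) fun _ => rfl

/-- Case distinction on a list. -/
theorem listCases {l : α → List β} {g : α → γ} {h : α → β → List β → γ} (hl : PolyTime l)
    (hg : PolyTime g) (hh : PolyTime fun z : α × β × List β => h z.1 z.2.1 z.2.2) :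
    PolyTime (fun x => match l x with | [] => g x | b :: t => h x b t) := by
  suffices H : PolyTime (fun z : α × List β => match z.2 with | [] => g z.1 | b :: t => h z.1 b t)
    from comp H (prodMk id hl)
  obtain ⟨c, p, hc⟩ := hg
  obtain ⟨d, q, hd⟩ := hh
  -- While the first letter of the list is inspected, the argument `x` that lies above it is kept
  -- on `aux`. For a nonempty list the two popped node letters are put back, so that the word of
  -- `(x, b, t)` is obtained.
  refine ⟨popMain fun _ => seq stash (popMain fun o : Option (Option Bool) =>
    match o with
    | some (some true) => seq (push .main (some true))
        (seq unstash (seq (push .main (some true)) d))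
    | _ => seq unstash c), 10 * .X + p + q + 40, ?_⟩
  rintro ⟨x, _ | ⟨y, t⟩⟩
  · have hp := eval_mono p (show size x ≤ size (x, ([] : List β)) by simp; omega)
    simp only at hp
    have hs := (hc x).2
    refine ⟨fun m a b e o => ?_, ?_⟩
    · rw [word_pair, word_nil]
      simp only [List.cons_append, List.append_assoc, List.nil_append]
      refine (runs_popMain ((runs_stash (toTree x) ..).seq (runs_popMain
        ((runs_unstash_tree (toTree x) ..).seq ((hc x).1 m a b e o))))).mono ?_
      simp at hp ⊢
      simp [size] at hp ⊢
      omega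
    · simp at hp ⊢
      omega
  · have hsz : size (x, y, t) = size (x, y :: t) := by simp
    refine ⟨fun m a b e o => ?_, ?_⟩
    · rw [word_pair, word_cons]
      simp only [List.cons_append, List.append_assoc]
      have hd' := (hd (x, y, t)).1 m a b e o
      rw [word_pair, word_pair] at hd'
      simp only [List.cons_append, List.append_assoc] at hd'
      refine (runs_popMain ((runs_stash (toTree x) ..).seq (runs_popMain
        ((runs_push_main ..).seq ((runs_unstash_tree (toTree x) ..).seq
        ((runs_push_main ..).seq hd')))))).mono ?_
      have : (toTree x).code.length ≤ size (x, y :: t) := by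
        change size x ≤ _
        simp
        omega
      rw [hsz]
      simp only [Polynomial.eval_add, Polynomial.eval_mul, Polynomial.eval_X,
        Polynomial.eval_ofNat]
      omega
    · have := (hd (x, y, t)).2
      rw [hsz] at this
      simp only [Polynomial.eval_add, Polynomial.eval_mul, Polynomial.eval_X,
        Polynomial.eval_ofNat] at this ⊢
      omega

/-- The loop of a program for `List.foldl`, where `c` is a program for one iteration. On `main`
lie the word of the list and below it the word of the pair of the parameter and the value computed
so far. They are joined to a pair by a letter `some true`, the program `c` is applied, and this
letter is removed from its result. -/
def foldLoop (c : Prog) : Prog :=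
  loop .main (fun o : Option (Option Bool) => o != some (some true)) fun o : Option (Option Bool) =>
    match o with
    | some (some true) => seq (push .main (some true)) (seq (push .main (some true))
        (seq c (popMain fun _ => skip)))
    | _ => skip

theorem runs_foldLoop {c : Prog} {h : α → σ → β → σ} {p : Polynomial ℕ}
    (hc : ∀ z : (β × List β) × (α × σ),
      Computes c z (z.1.2, (z.2.1, h z.2.1 z.2.2 z.1.1)) (p.eval (size z)))
    (x : α) (l : List β) (s : σ) (A B : ℕ) (hA : size l ≤ A)
    (hB : ∀ l', l' <+: l → size (l'.foldl (h x) s) ≤ B) (m a b d : List (Option Bool))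
    (o : List Bool) :
    Runs (foldLoop c) (st (word l ++ (word (x, s) ++ m)) a b d o)
      (st (word (x, l.foldl (h x) s) ++ m) a b d o)
      (l.length * (p.eval (A + B + size x + 2) + 8) + 2) := by
  induction l generalizing s with
  | nil => exact (runs_loop_main_last rfl (runs_skip _)).mono (by omega)
  | cons y l ih =>
    have hs : size s ≤ B := hB [] (List.nil_prefix)
    have h1 := ih (h x s y) (by simp at hA; omega) fun l' hl' => by
      simpa using hB (y :: l') (List.cons_prefix_cons.2 ⟨rfl, hl'⟩)
    have h2 := hc ((y, l), (x, s)) m a b d o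
    have h3 : size ((y, l), (x, s)) ≤ A + B + size x + 2 := by
      simp at hA ⊢
      omega
    have h4 := eval_mono p h3
    simp only at h4
    rw [word_pair, word_pair, word_pair (β := α × σ)] at h2
    rw [word_cons]
    simp only [List.cons_append, List.append_assoc] at h2 ⊢
    refine (runs_loop_main_next rfl ((runs_push_main ..).seq ((runs_push_main ..).seq
      (h2.seq (runs_popMain (runs_skip _))))) h1).mono ?_
    rw [List.length_cons, Nat.succ_mul]
    omega

/-- A fold is computable in polynomial time if all its intermediate values have polynomial size. -/
theorem foldl_of_size_le {l : α → List β} {i : α → σ} {h : α → σ → β → σ} (hl : PolyTime l)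
    (hi : PolyTime i) (hh : PolyTime fun z : α × σ × β => h z.1 z.2.1 z.2.2)
    (hsize : ∃ q : Polynomial ℕ, ∀ x l', l' <+: l x →
      size (l'.foldl (h x) (i x)) ≤ q.eval (size x)) :
    PolyTime (fun x => (l x).foldl (h x) (i x)) := by
  obtain ⟨q, hq⟩ := hsize
  obtain ⟨r, hr⟩ := hl.size_le
  obtain ⟨c, p, hc⟩ : PolyTime fun z : (β × List β) × (α × σ) =>
      (z.1.2, (z.2.1, h z.2.1 z.2.2 z.1.1)) := by
    have : PolyTime fun z : (β × List β) × (α × σ) => h z.2.1 z.2.2 z.1.1 :=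
      comp hh (by fun_prop : PolyTime fun z : (β × List β) × (α × σ) => (z.2.1, z.2.2, z.1.1))
    fun_prop
  obtain ⟨d, p', hd⟩ : PolyTime fun x => (l x, (x, i x)) := by fun_prop
  suffices H : PolyTime (fun x => (x, (l x).foldl (h x) (i x))) from snd H
  refine ⟨seq d (popMain fun _ => foldLoop c),
    p' + r * (p.comp (r + q + .X + 2) + 8) + q + .X + 8, fun x => ⟨fun m a b e o => ?_, ?_⟩⟩
  · have h1 := (hd x).1 m a b e o
    rw [word_pair] at h1
    simp only [List.cons_append, List.append_assoc] at h1
    refine (h1.seq (runs_popMain (runs_foldLoop (fun z => (hc z).1) x (l x) (i x) _ _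
      (hr x) (hq x) m a b e o))).mono ?_
    have h2 := Nat.mul_le_mul_right
      (p.eval (r.eval (size x) + q.eval (size x) + size x + 2) + 8)
      ((length_le_size (l x)).trans (hr x))
    simp
    omega
  · have := hq x (l x) List.prefix_rfl
    simp
    omega

/-- A fold is computable in polynomial time if a single step increases the size only by an amount
that is bounded in terms of the parameters. -/
theorem foldl {l : α → List β} {i : α → σ} {h : α → σ → β → σ} (hl : PolyTime l)
    (hi : PolyTime i) (hh : PolyTime fun z : α × σ × β => h z.1 z.2.1 z.2.2) (q : Polynomial ℕ)
    (hq : ∀ x s b, size (h x s b) ≤ size s + q.eval (size x + size b)) :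
    PolyTime (fun x => (l x).foldl (h x) (i x)) := by
  obtain ⟨r, hr⟩ := hl.size_le
  obtain ⟨p, hp⟩ := hi.size_le
  refine foldl_of_size_le hl hi hh ⟨p + r * q.comp (.X + r), fun x l' hl' => ?_⟩
  have key : ∀ (l' : List β) (s : σ), (∀ b ∈ l', b ∈ l x) → size (l'.foldl (h x) s) ≤
      size s + l'.length * q.eval (size x + r.eval (size x)) := by
    intro l'
    induction l' with
    | nil => simp
    | cons b l' ih =>
      intro s hb
      have h1 := ih (h x s b) fun b' hb' => hb b' (List.mem_cons_of_mem _ hb')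
      have h2 := hq x s b
      have h3 := eval_mono q (Nat.add_le_add_left
        ((size_le_of_mem (hb b List.mem_cons_self)).trans (hr x)) (size x))
      simp only [List.foldl_cons, List.length_cons, Nat.succ_mul] at h1 h3 ⊢
      omega
  have h1 := key l' (i x) fun b hb => hl'.subset hb
  have h2 := Nat.mul_le_mul_right (q.eval (size x + r.eval (size x)))
    (hl'.length_le.trans ((length_le_size _).trans (hr x)))
  have h3 := hp x
  simp
  omega

end PolyTime

end StackProgram

namespace StackProgram

namespace PolyTime

variable {α β γ σ : Type} [ToTree α] [ToTree β] [ToTree γ] [ToTree σ]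

/-! ### Polynomial-time operations on Booleans, numbers and lists -/

theorem ite {c : α → Bool} {f g : α → β} (hc : PolyTime c) (hf : PolyTime f) (hg : PolyTime g) :
    PolyTime (fun x => if c x then f x else g x) := by
  -- `true` is represented by the same tree as `[()]`, and `false` by the same tree as `[]`.
  have hl : PolyTime fun x => if c x then [()] else [] :=
    hc.of_toTree_eq (e := _root_.id) (fun _ => rfl) fun x => by
      cases h : c x <;> simp [h] <;> rfl
  have hf' : PolyTime fun z : α × Unit × List Unit => f z.1 := hf.comp (fst id)
  refine (listCases (h := fun x _ _ => f x) hl hg hf').of_toTree_eq (e := _root_.id)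
    (fun _ => rfl) fun x => ?_
  cases h : c x <;> simp [h]

@[fun_prop]
theorem not {c : α → Bool} (hc : PolyTime c) : PolyTime (fun x => !c x) := by
  have := ite hc (const false) (const true)
  convert this using 2 with x
  cases c x <;> rfl

@[fun_prop]
theorem and {c d : α → Bool} (hc : PolyTime c) (hd : PolyTime d) :
    PolyTime (fun x => c x && d x) := by
  convert ite hc hd (const false) using 2 with x
  cases c x <;> rfl

@[fun_prop]
theorem xor {c d : α → Bool} (hc : PolyTime c) (hd : PolyTime d) :
    PolyTime (fun x => c x ^^ d x) := by
  convert ite hc (not hd) hd using 2 with x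
  cases c x <;> simp

@[fun_prop]
theorem isEmpty {l : α → List β} (hl : PolyTime l) : PolyTime (fun x => (l x).isEmpty) := by
  convert listCases (h := fun _ _ _ => false) hl (const true) (const false) using 2 with x
  cases l x <;> rfl

theorem foldl_succ_eq {β : Type} (l : List β) (n : ℕ) :
    l.foldl (fun k _ => k + 1) n = n + l.length := by
  induction l generalizing n with
  | nil => rfl
  | cons b l ih => simp [ih]; omega

@[fun_prop]
theorem succ {f : α → ℕ} (hf : PolyTime f) : PolyTime (fun x => f x + 1) :=
  ((const ()).prodMk hf).of_toTree_eq (e := _root_.id) (fun _ => rfl) fun _ => rfl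

@[fun_prop]
theorem replicate {f : α → ℕ} (hf : PolyTime f) :
    PolyTime (fun x => List.replicate (f x) ()) := by
  -- In unary, `n` is represented by the same tree as a list of `n` units.
  refine hf.of_toTree_eq (e := _root_.id) (fun _ => rfl) fun x => ?_
  change _ = toTree (f x)
  induction f x with
  | zero => rfl
  | succ n ih =>
    change Tree.node .leaf (toTree (List.replicate n ())) = Tree.node .leaf (toTree n)
    rw [ih]

@[fun_prop]
theorem length {l : α → List β} (hl : PolyTime l) : PolyTime (fun x => (l x).length) := by
  have := foldl (h := fun _ (k : ℕ) _ => k + 1) hl (const 0) (by fun_prop) 2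
    fun x s b => by simp; omega
  simpa only [foldl_succ_eq, zero_add] using this

@[fun_prop]
theorem add {f g : α → ℕ} (hf : PolyTime f) (hg : PolyTime g) :
    PolyTime (fun x => f x + g x) := by
  have := foldl (h := fun _ (k : ℕ) _ => k + 1) (replicate hg) hf (by fun_prop) 2
    fun x s b => by simp; omega
  simpa only [foldl_succ_eq, List.length_replicate] using this

theorem pred {f : α → ℕ} (hf : PolyTime f) : PolyTime (fun x => f x - 1) := by
  have := listCases (h := fun _ _ t => t.length) (replicate hf) (const 0) (by fun_prop)
  convert this using 2 with x
  cases f x <;> simp [List.replicate_succ]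

@[fun_prop]
theorem sub {f g : α → ℕ} (hf : PolyTime f) (hg : PolyTime g) :
    PolyTime (fun x => f x - g x) := by
  have := foldl (h := fun _ (k : ℕ) _ => k - 1) (replicate hg) hf (pred (by fun_prop)) 0
    fun x s b => by simp
  convert this using 2 with x
  induction g x with
  | zero => rfl
  | succ n ih => rw [List.replicate_succ', List.foldl_concat, ← ih]; rfl

@[fun_prop]
theorem mul {f g : α → ℕ} (hf : PolyTime f) (hg : PolyTime g) :
    PolyTime (fun x => f x * g x) := by
  suffices H : PolyTime fun z : ℕ × ℕ => z.1 * z.2 from H.comp (hf.prodMk hg)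
  have := foldl (h := fun (z : ℕ × ℕ) (k : ℕ) _ => k + z.1) (l := fun z => List.replicate z.2 ())
    (by fun_prop) (const 0) (by fun_prop) .X fun x s b => by obtain ⟨x, y⟩ := x; simp; omega
  convert this using 2 with z
  induction z.2 with
  | zero => rfl
  | succ n ih => rw [List.replicate_succ', List.foldl_concat, ← ih]; rfl

@[fun_prop]
theorem ble {f g : α → ℕ} (hf : PolyTime f) (hg : PolyTime g) :
    PolyTime (fun x => Nat.ble (f x) (g x)) := by
  have : PolyTime fun x => (List.replicate (f x - g x) ()).isEmpty := by fun_prop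
  convert this using 2 with x
  rw [Bool.eq_iff_iff]
  simp [Nat.sub_eq_zero_iff_le]

@[fun_prop]
theorem beq {f g : α → ℕ} (hf : PolyTime f) (hg : PolyTime g) :
    PolyTime (fun x => Nat.beq (f x) (g x)) := by
  have : PolyTime fun x => Nat.ble (f x) (g x) && Nat.ble (g x) (f x) := by fun_prop
  convert this using 2 with x
  rw [Bool.eq_iff_iff, Bool.and_eq_true, Nat.ble_eq, Nat.ble_eq, Nat.beq_eq]
  exact le_antisymm_iff

theorem foldl_cons_eq {β : Type} (l l' : List β) :
    l.foldl (fun s b => b :: s) l' = l.reverse ++ l' := by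
  induction l generalizing l' with
  | nil => rfl
  | cons b l ih => simp [ih]

@[fun_prop]
theorem reverse {l : α → List β} (hl : PolyTime l) : PolyTime (fun x => (l x).reverse) := by
  have := foldl (h := fun _ s b => b :: s) hl (const []) (by fun_prop) (.X + 1)
    fun x s b => by simp; omega
  simpa only [foldl_cons_eq, List.append_nil] using this

@[fun_prop]
theorem append {l l' : α → List β} (hl : PolyTime l) (hl' : PolyTime l') :
    PolyTime (fun x => l x ++ l' x) := by
  have := foldl (h := fun _ s b => b :: s) (reverse hl) hl' (by fun_prop) (.X + 1)
    fun x s b => by simp; omega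
  simpa only [foldl_cons_eq, List.reverse_reverse] using this

theorem filter {l : α → List β} {p : α → β → Bool} (hl : PolyTime l)
    (hp : PolyTime fun z : α × β => p z.1 z.2) : PolyTime (fun x => (l x).filter (p x)) := by
  have hp' : PolyTime fun z : α × List β × β => p z.1 z.2.2 :=
    hp.comp (by fun_prop : PolyTime fun z : α × List β × β => (z.1, z.2.2))
  have := reverse <| foldl (h := fun x s b => if p x b then b :: s else s) hl (const [])
    (ite hp' (by fun_prop) (by fun_prop)) (.X + 1) fun x s b => by split <;> simp; omega
  convert this using 2 with x
  have key : ∀ (l l' : List β), l.foldl (fun s b => if p x b then b :: s else s) l' =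
      (l.filter (p x)).reverse ++ l' := by
    intro l
    induction l with
    | nil => simp
    | cons b l ih =>
      intro l'
      by_cases h : p x b <;> simp [h, ih]
  simp [key]

theorem countP {l : α → List β} {p : α → β → Bool} (hl : PolyTime l)
    (hp : PolyTime fun z : α × β => p z.1 z.2) : PolyTime (fun x => (l x).countP (p x)) := by
  simpa only [List.countP_eq_length_filter] using length (filter hl hp)

theorem all {l : α → List β} {p : α → β → Bool} (hl : PolyTime l)
    (hp : PolyTime fun z : α × β => p z.1 z.2) : PolyTime (fun x => (l x).all (p x)) := by
  have := isEmpty (filter (p := fun x b => !p x b) hl (not hp))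
  convert this using 2 with x
  rw [Bool.eq_iff_iff]
  simp [List.filter_eq_nil_iff]

/-- An iteration is computable in polynomial time if all its intermediate values have polynomial
size. -/
theorem iterate {f : α → σ → σ} {n : α → ℕ} {i : α → σ} (hn : PolyTime n) (hi : PolyTime i)
    (hf : PolyTime fun z : α × σ => f z.1 z.2)
    (hsize : ∃ q : Polynomial ℕ, ∀ x, ∀ k ≤ n x, size ((f x)^[k] (i x)) ≤ q.eval (size x)) :
    PolyTime (fun x => (f x)^[n x] (i x)) := by
  have key : ∀ (x : α) (l : List Unit), l.foldl (fun s _ => f x s) (i x) =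
      (f x)^[l.length] (i x) := by
    intro x l
    induction l using List.reverseRecOn with
    | nil => rfl
    | append_singleton l b ih =>
      rw [List.foldl_concat, ih, List.length_append, List.length_singleton,
        Function.iterate_succ_apply']
  obtain ⟨q, hq⟩ := hsize
  have := foldl_of_size_le (h := fun x s _ => f x s) (replicate hn) hi
    (hf.comp (by fun_prop : PolyTime fun z : α × σ × Unit => (z.1, z.2.1)))
    ⟨q, fun x l' hl' => by
      rw [key]
      exact hq x _ (by simpa using hl'.length_le)⟩
  simpa only [key, List.length_replicate] using this

/-! ### Binary representation of a number -/

/-- The binary representation, least significant bit first, of the successor. -/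
def incr : List Bool → List Bool
  | [] => [true]
  | false :: l => true :: l
  | true :: l => false :: incr l

theorem encodeNat_succ (n : ℕ) :
    Computability.encodeNat (n + 1) = incr (Computability.encodeNat n) := by
  have key : ∀ p : PosNum, Computability.encodePosNum p.succ =
      incr (Computability.encodePosNum p) := by
    intro p
    induction p with
    | one => rfl
    | bit0 p ih => rfl
    | bit1 p ih => simp [PosNum.succ, Computability.encodePosNum, incr, ih]
  unfold Computability.encodeNat
  rw [Nat.cast_succ, Num.add_one]
  cases (n : Num) with
  | zero => rfl
  | pos p => exact key p

/-- One step of the addition of `1`, from the least significant bit on: the state consists of the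
carry and of the reversed list of the bits computed so far. -/
def incrStep (s : Bool × List Bool) (b : Bool) : Bool × List Bool := (s.1 && b, (s.1 ^^ b) :: s.2)

theorem incr_eq (l : List Bool) : incr l =
    (if (l.foldl incrStep (true, [])).1 then true :: (l.foldl incrStep (true, [])).2
      else (l.foldl incrStep (true, [])).2).reverse := by
  have h0 : ∀ (l acc : List Bool), l.foldl incrStep (false, acc) = (false, l.reverse ++ acc) := by
    intro l
    induction l with
    | nil => simp
    | cons b l ih =>
      intro acc
      rw [List.foldl_cons]
      simp [incrStep, ih]
  have h1 : ∀ (l acc : List Bool), (if (l.foldl incrStep (true, acc)).1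
      then true :: (l.foldl incrStep (true, acc)).2
      else (l.foldl incrStep (true, acc)).2).reverse = acc.reverse ++ incr l := by
    intro l
    induction l with
    | nil => simp [incr]
    | cons b l ih =>
      intro acc
      cases b
      · rw [List.foldl_cons]
        simp [incrStep, h0, incr]
      · rw [List.foldl_cons, show incrStep (true, acc) true = (true, false :: acc) from rfl, ih]
        simp [incr]
  exact (h1 l []).symm

theorem polyTime_incr {f : α → List Bool} (hf : PolyTime f) : PolyTime (fun x => incr (f x)) := by
  refine comp (g := incr) ?_ hf
  have h : PolyTime fun l : List Bool => l.foldl incrStep (true, []) :=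
    foldl (h := fun _ => incrStep) id (const _) (by unfold incrStep; fun_prop) 7 fun x s b => by
      obtain ⟨c, s⟩ := s
      have h1 := size_bool_le (c && b)
      have h2 := size_bool_le (c ^^ b)
      have h3 := size_pos c
      simp [incrStep]
      omega
  rw [funext incr_eq]
  exact reverse (ite (fst h) (cons (const true) (snd h)) (snd h))

@[fun_prop]
theorem encodeNat {f : α → ℕ} (hf : PolyTime f) :
    PolyTime (fun x => Computability.encodeNat (f x)) := by
  refine comp (g := Computability.encodeNat) ?_ hf
  have key : ∀ n : ℕ, incr^[n] [] = Computability.encodeNat n := by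
    intro n
    induction n with
    | zero => rfl
    | succ n ih => rw [Function.iterate_succ_apply', ih, encodeNat_succ]
  have hs : ∀ l : List Bool, size (incr l) ≤ size l + 4 := by
    intro l
    induction l with
    | nil => decide
    | cons b l ih =>
      have h0 : size false = 1 := rfl
      have h1 : size true = 3 := rfl
      cases b <;> simp [incr] <;> omega
  have := iterate (f := fun _ => incr) (i := fun _ : ℕ => []) id (const [])
    (polyTime_incr (snd id)) ⟨4 * .X + 1, fun n k hk => by
      have : ∀ k : ℕ, size (incr^[k] []) ≤ 4 * k + 1 := by
        intro k
        induction k with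
        | zero => simp
        | succ k ih =>
          rw [Function.iterate_succ_apply']
          have := hs (incr^[k] [])
          omega
      have := this k
      simp
      omega⟩
  simpa only [key] using this

end PolyTime

end StackProgram

namespace StackProgram

open Function Cmd

/-! ### Input and output -/

/-- An element of `Option Bool` is represented like a list of length at most `1`. -/
instance : ToTree (Option Bool) := ⟨fun o => toTree o.toList⟩

theorem size_option_le (o : Option Bool) : size o ≤ 5 := by
  rcases o with _ | _ | _ <;> decide

theorem size_input_le (l : List (Option Bool)) : size l ≤ 6 * l.length + 1 := by
  induction l with
  | nil => simp
  | cons a l ih =>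
    have := size_option_le a
    simp
    omega

/-- Move all letters from `aux` to `tmp`. -/
def auxToTmp : Prog :=
  loop .aux (fun o : Option (Option Bool) => o.isNone) fun o : Option (Option Bool) =>
    match o with
    | some l => push .tmp l
    | none => skip

theorem runs_auxToTmp (l m b c : List (Option Bool)) (o : List Bool) :
    Runs auxToTmp (st m l b c o) (st m [] (l.reverse ++ b) c o) (2 * l.length + 2) := by
  induction l generalizing b with
  | nil =>
    refine runs_loop_last rfl ?_
    rw [update_aux]
    exact runs_skip _
  | cons x l ih =>
    simp only [List.reverse_cons, List.append_assoc]
    exact (runs_loop_aux_next rfl (runs_push_tmp ..) (ih _)).mono (by simp; omega)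

/-- Move all letters from `tmp` to `main`, where they are prepended, in their representation as
trees, to a list. -/
def tmpToMain : Prog :=
  loop .tmp (fun o : Option (Option Bool) => o.isNone) fun o : Option (Option Bool) =>
    match o with
    | some l => seq (PolyTime.pushWord (toTree l).code) (push .main (some true))
    | none => skip

theorem runs_tmpToMain (l l' m a c : List (Option Bool)) (o : List Bool) :
    Runs tmpToMain (st (word l' ++ m) a l c o) (st (word (l.reverse ++ l') ++ m) a [] c o)
      (14 * l.length + 2) := by
  induction l generalizing l' with
  | nil =>
    refine runs_loop_last rfl ?_
    rw [update_tmp]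
    exact runs_skip _
  | cons x l ih =>
    simp only [List.reverse_cons, List.append_assoc]
    have h1 := size_option_le x
    have h2 := ih (x :: l')
    rw [word_cons, List.cons_append, List.append_assoc] at h2
    refine (runs_loop_tmp_next rfl ((PolyTime.runs_pushWord (toTree x).code ..).seq
      (runs_push_main ..)) h2).mono ?_
    simp [size] at h1 ⊢
    omega

/-- Pop a list of Booleans from `main` and push its entries to `out`, the first one first. The word
of `true` has length `3`, that of `false` has length `1`. -/
def writeOutput : Prog :=
  loop .main (fun o : Option (Option Bool) => o != some (some true)) fun o : Option (Option Bool) =>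
    match o with
    | some (some true) => popMain fun o : Option (Option Bool) =>
        match o with
        | some (some true) =>
            seq (popMain fun _ => skip) (seq (popMain fun _ => skip) (push .out true))
        | _ => push .out false
    | _ => skip

theorem runs_writeOutput (l : List Bool) (m a b c : List (Option Bool)) (o : List Bool) :
    Runs writeOutput (st (word l ++ m) a b c o) (st m a b c (l.reverse ++ o))
      (9 * l.length + 2) := by
  induction l generalizing o with
  | nil => exact (runs_loop_main_last rfl (runs_skip _)).mono (by omega)
  | cons x l ih =>
    simp only [List.reverse_cons, List.append_assoc]
    rw [word_cons, List.cons_append, List.append_assoc]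
    cases x
    · exact (runs_loop_main_next rfl (runs_popMain (runs_push_out ..)) (ih _)).mono
        (by simp; omega)
    · exact (runs_loop_main_next rfl (runs_popMain ((runs_popMain (runs_skip _)).seq
        ((runs_popMain (runs_skip _)).seq (runs_push_out ..)))) (ih _)).mono (by simp; omega)

theorem initList_machine (c : Prog) (w : List (Option Bool)) :
    Turing.initList (machine c .aux .out) w =
      ⟨some (toLabel c [c]), fun _ => none, st [] w [] [] []⟩ :=
  congrArg (Turing.TM2.Cfg.mk _ _) (funext fun k => by cases k <;> rfl)

theorem haltList_machine (c : Prog) (w : List Bool) :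
    Turing.haltList (machine c .aux .out) w = ⟨none, fun _ => none, st [] [] [] [] w⟩ :=
  congrArg (Turing.TM2.Cfg.mk _ _) (funext fun k => by cases k <;> rfl)

/-- A function that is computed in polynomial time by a stack program on trees is computed in
polynomial time by a Turing machine. -/
theorem PolyTime.nonempty_tm2 {α β : Type} {ea : α → List (Option Bool)} {eb : β → List Bool}
    {f : α → β} {F : List (Option Bool) → List Bool} (hF : PolyTime F)
    (h : ∀ x, F (ea x) = eb (f x)) :
    Nonempty (Turing.TM2ComputableInPolyTime ea eb f) := by
  -- The output is written in reverse order.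
  obtain ⟨c, p, hc⟩ := reverse hF
  set prog : Prog := seq auxToTmp (seq (push .main (some false)) (seq tmpToMain
    (seq c writeOutput)))
  have key : ∀ x, Runs prog (st [] (ea x) [] [] []) (st [] [] [] [] (eb (f x)))
      ((10 * p.comp (6 * .X + 1) + 16 * .X + 20 : Polynomial ℕ).eval (ea x).length) := by
    intro x
    have h1 := runs_auxToTmp (ea x) [] [] [] []
    have h2 := runs_tmpToMain ((ea x).reverse ++ []) [] [] [] [] []
    have h3 := (hc (ea x)).1 [] [] [] [] []
    have h4 := runs_writeOutput (F (ea x)).reverse [] [] [] [] []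
    simp only [List.append_nil, List.reverse_reverse, h] at h1 h2 h3 h4
    have h5 := eval_mono p (size_input_le (ea x))
    have h6 := (length_le_size _).trans (hc (ea x)).2
    refine (h1.seq ((runs_push_main ..).seq (h2.seq (h3.seq h4)))).mono ?_
    simp [h] at h5 h6 ⊢
    omega
  have key' := fun x => (key x).exists_iterate_step .aux .out
  choose s hs hs' using key'
  exact ⟨{
    tm := machine prog .aux .out
    inputAlphabet := Equiv.refl (Option Bool)
    outputAlphabet := Equiv.refl Bool
    time := 10 * p.comp (6 * .X + 1) + 16 * .X + 21
    outputsFun := fun x => {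
      steps := s x
      evals_in_steps := by
        have hi := (congrArg (Turing.initList (machine prog .aux .out))
          (List.map_id (ea x))).trans (initList_machine prog (ea x))
        have ho := (congrArg (Turing.haltList (machine prog .aux .out))
          (List.map_id (eb (f x)))).trans (haltList_machine prog (eb (f x)))
        refine Eq.trans ?_ ((hs' x).trans (congrArg some ho.symm))
        exact congrArg (fun z => (flip bind (machine prog .aux .out).step)^[s x] (some z)) hi
      steps_le_m := by
        refine (hs x).trans ?_
        simp } }⟩

end StackProgram

/-! ### The algorithm -/

namespace StarArboricity

/-- The number of edges with tail `v` in a list of directed edges. -/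
def outDeg (E : List (ℕ × ℕ)) (v : ℕ) : ℕ := E.countP fun e => Nat.beq e.1 v

/-- The number of edges with head `v` in a list of directed edges. -/
def inDeg (E : List (ℕ × ℕ)) (v : ℕ) : ℕ := E.countP fun e => Nat.beq e.2 v

/-- The height of `v`. The height function is stored as a list of vertices in which every vertex
occurs as often as its height says. -/
def height (L : List ℕ) (v : ℕ) : ℕ := L.countP fun w => Nat.beq w v

/-- A state of the push-relabel algorithm: a list of directed edges and a list of vertices that
stores the heights. -/
abbrev State : Type := List (ℕ × ℕ) × List ℕ

/-- A directed edge is admissible if its tail has out-degree at least `k` and is by one higher than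
its head. -/
def admissible (k : ℕ) (s : State) (e : ℕ × ℕ) : Bool :=
  Nat.ble k (outDeg s.1 e.1) && Nat.beq (height s.2 e.1) (height s.2 e.2 + 1)

/-- The tail of a directed edge can be lifted if it has out-degree at least `k` and height at
most `n`. -/
def liftable (k n : ℕ) (s : State) (e : ℕ × ℕ) : Bool :=
  Nat.ble k (outDeg s.1 e.1) && Nat.ble (height s.2 e.1) n

/-- One step of the push-relabel algorithm that looks for an orientation in which all out-degrees
are less than `k`: reverse an admissible edge; if there is none, lift the tail of a liftable
edge. -/
def step (k n : ℕ) (s : State) : State :=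
  match s.1.filter (admissible k s) with
  | e :: r => ((e.2, e.1) :: (r ++ s.1.filter fun e => !admissible k s e), s.2)
  | [] =>
    match s.1.filter (liftable k n s) with
    | e :: _ => (s.1, e.1 :: s.2)
    | [] => s

/-- The edges both ends of which have degree more than `k`. -/
def core (k : ℕ) (E : List (ℕ × ℕ)) : List (ℕ × ℕ) :=
  E.filter fun e => Nat.ble (k + 1) (outDeg E e.1 + inDeg E e.1) &&
    Nat.ble (k + 1) (outDeg E e.2 + inDeg E e.2)

/-- A number of steps after which the algorithm is finished. -/
def fuel (n : ℕ) (E : List (ℕ × ℕ)) : ℕ := (E.length + 1) * (n * (n + 1))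

/-- The final state of the push-relabel algorithm. -/
def final (k n : ℕ) (E : List (ℕ × ℕ)) : State :=
  (step k n)^[fuel n E] (E, [])

/-- The test whether a graph on `n` vertices with edges `E` has local star arboricity at
most `k`. -/
def test (k n : ℕ) (E : List (ℕ × ℕ)) : Bool :=
  (final k n (core k E)).1.all fun e => !Nat.ble k (outDeg (final k n (core k E)).1 e.1)

/-- One step of the computation of the number of failures of the test. The state consists of the
next value to be tested and of the number of failures so far. -/
def failuresStep (n : ℕ) (E : List (ℕ × ℕ)) (s : ℕ × ℕ) : ℕ × ℕ :=
  (s.1 + 1, if test s.1 n E then s.2 else s.2 + 1)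

/-- The number `m`, and the number of `k < m` for which the test fails. -/
def failures (n : ℕ) (E : List (ℕ × ℕ)) (m : ℕ) : ℕ × ℕ := (failuresStep n E)^[m] (0, 0)

/-- Reading of one letter of the adjacency matrix. The state consists of the current row, the
current column and the edges found so far; only entries below the diagonal are used. -/
def readStep (s : ℕ × ℕ × List (ℕ × ℕ)) (o : Option Bool) : ℕ × ℕ × List (ℕ × ℕ) :=
  match o.toList with
  | [] => (s.1 + 1, 0, s.2.2)
  | b :: _ => (s.1, s.2.1 + 1,
      if b && Nat.ble (s.2.1 + 1) s.1 then (s.1, s.2.1) :: s.2.2 else s.2.2)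

/-- The number of rows of an adjacency matrix, the column after the last letter, and the edges. -/
def readGraph (w : List (Option Bool)) : ℕ × ℕ × List (ℕ × ℕ) := w.foldl readStep (0, 0, [])

/-- The local star arboricity, computed from the adjacency matrix. -/
def algorithm (w : List (Option Bool)) : ℕ :=
  (failures (readGraph w).1 (readGraph w).2.2 (readGraph w).1).2

/-! ### The algorithm runs in polynomial time -/

open StackProgram

variable {α : Type} [ToTree α]

@[fun_prop]
theorem polyTime_outDeg {f : α → List (ℕ × ℕ)} {g : α → ℕ} (hf : PolyTime f) (hg : PolyTime g) :
    PolyTime fun x => outDeg (f x) (g x) :=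
  PolyTime.countP (p := fun x (e : ℕ × ℕ) => Nat.beq e.1 (g x)) hf (by fun_prop)

@[fun_prop]
theorem polyTime_inDeg {f : α → List (ℕ × ℕ)} {g : α → ℕ} (hf : PolyTime f) (hg : PolyTime g) :
    PolyTime fun x => inDeg (f x) (g x) :=
  PolyTime.countP (p := fun x (e : ℕ × ℕ) => Nat.beq e.2 (g x)) hf (by fun_prop)

@[fun_prop]
theorem polyTime_height {f : α → List ℕ} {g : α → ℕ} (hf : PolyTime f) (hg : PolyTime g) :
    PolyTime fun x => height (f x) (g x) :=
  PolyTime.countP (p := fun x (v : ℕ) => Nat.beq v (g x)) hf (by fun_prop)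

theorem polyTime_step :
    PolyTime fun z : (ℕ × ℕ × List (ℕ × ℕ)) × State =>
      step z.1.1 z.1.2.1 z.2 := by
  have h1 : PolyTime fun z : ((ℕ × ℕ × List (ℕ × ℕ)) × State) × (ℕ × ℕ) =>
      admissible z.1.1.1 z.1.2 z.2 := by
    unfold admissible
    fun_prop
  have h2 : PolyTime fun z : ((ℕ × ℕ × List (ℕ × ℕ)) × State) × (ℕ × ℕ) =>
      liftable z.1.1.1 z.1.1.2.1 z.1.2 z.2 := by
    unfold liftable
    fun_prop
  have h3 := PolyTime.filter (l := fun z : (ℕ × ℕ × List (ℕ × ℕ)) × State => z.2.1)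
    (p := fun z e => admissible z.1.1 z.2 e)
    (by fun_prop) h1
  have h4 := PolyTime.filter (l := fun z : (ℕ × ℕ × List (ℕ × ℕ)) × State => z.2.1)
    (p := fun z e => !admissible z.1.1 z.2 e)
    (by fun_prop) (PolyTime.not h1)
  have h5 := PolyTime.filter (l := fun z : (ℕ × ℕ × List (ℕ × ℕ)) × State => z.2.1)
    (p := fun z e => liftable z.1.1 z.1.2.1 z.2 e) (by fun_prop) h2
  have h6 := PolyTime.listCases h5 (g := fun z => z.2)
    (h := fun (z : (ℕ × ℕ × List (ℕ × ℕ)) × State) (e : ℕ × ℕ) _ => (z.2.1, e.1 :: z.2.2))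
    (by fun_prop) (by fun_prop)
  have h7 := h4.comp (PolyTime.fst
    (PolyTime.id (α := ((ℕ × ℕ × List (ℕ × ℕ)) × State) × (ℕ × ℕ) × List (ℕ × ℕ))))
  have h8 := PolyTime.listCases h3 h6 (h := fun z e r => ((e.2, e.1) ::
      (r ++ z.2.1.filter fun e => !admissible z.1.1 z.2 e), z.2.2))
    (PolyTime.prodMk (PolyTime.cons (by fun_prop) (PolyTime.append (by fun_prop) h7))
      (by fun_prop))
  convert h8 using 2 with z
  unfold step
  cases z.2.1.filter (admissible z.1.1 z.2) with
  | nil => cases z.2.1.filter (liftable z.1.1 z.1.2.1 z.2) <;> rfl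
  | cons => rfl

theorem size_filter_add_size_filter_not (p : ℕ × ℕ → Bool) (E : List (ℕ × ℕ)) :
    size (E.filter p) + size (E.filter fun e => !p e) = size E + 1 := by
  induction E with
  | nil => simp
  | cons e E ih => cases h : p e <;> simp [h] <;> omega

theorem size_step_fst_le (k n : ℕ) (s : State) :
    size (step k n s).1 ≤ size s.1 := by
  have h1 := size_filter_add_size_filter_not (admissible k s) s.1
  unfold step
  split
  · next e r h =>
    have h2 := size_append r (s.1.filter fun e => !admissible k s e)
    rw [h] at h1
    obtain ⟨u, v⟩ := e
    simp only [size_cons, size_pair] at h1 ⊢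
    omega
  · split <;> rfl

theorem size_step_snd_le (k n : ℕ) (s : State) :
    size (step k n s).2 ≤ size s.2 + (size s.1 + 1) := by
  unfold step
  split
  · simp
  · split
    · next e r h =>
      have := size_le_of_mem (List.mem_of_mem_filter (h ▸ List.mem_cons_self : e ∈ _))
      obtain ⟨u, v⟩ := e
      simp at *
      omega
    · omega

theorem polyTime_fuel {f : α → ℕ} {g : α → List (ℕ × ℕ)} (hf : PolyTime f) (hg : PolyTime g) :
    PolyTime fun x => fuel (f x) (g x) := by
  unfold fuel
  fun_prop

theorem polyTime_final : PolyTime fun x : ℕ × ℕ × List (ℕ × ℕ) => final x.1 x.2.1 x.2.2 := by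
  have hf : PolyTime fun x : ℕ × ℕ × List (ℕ × ℕ) => fuel x.2.1 x.2.2 :=
    polyTime_fuel (by fun_prop) (by fun_prop)
  obtain ⟨q, hq⟩ := hf.size_le
  refine PolyTime.iterate (f := fun x : ℕ × ℕ × List (ℕ × ℕ) => step x.1 x.2.1) hf
    (by fun_prop) polyTime_step ⟨.X + q * (.X + 1) + 2, fun x k hk => ?_⟩
  have h1 : ∀ k, size ((step x.1 x.2.1)^[k] (x.2.2, [])).1 ≤ size x.2.2 := by
    intro k
    induction k with
    | zero => rfl
    | succ k ih =>
      rw [Function.iterate_succ_apply']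
      exact (size_step_fst_le _ _ _).trans ih
  have h2 : ∀ k, size ((step x.1 x.2.1)^[k] (x.2.2, [])).2 ≤ 1 + k * (size x.2.2 + 1) := by
    intro k
    induction k with
    | zero => simp
    | succ k ih =>
      rw [Function.iterate_succ_apply', Nat.succ_mul]
      have := size_step_snd_le x.1 x.2.1 ((step x.1 x.2.1)^[k] (x.2.2, []))
      have := h1 k
      omega
  have h3 : k ≤ q.eval (size x) := by
    have := hq x
    rw [size_nat] at this
    omega
  have h4 : size x.2.2 ≤ size x := by
    obtain ⟨a, b, c⟩ := x
    simp
    omega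
  have h5 := Nat.mul_le_mul h3 (Nat.add_le_add_right h4 1)
  have h6 := h1 k
  have h7 := h2 k
  have h8 : ∀ z : State, size z = size z.1 + size z.2 + 1 := fun z => size_pair _ _
  rw [h8]
  simp
  omega

@[fun_prop]
theorem polyTime_final_comp {f g : α → ℕ} {h : α → List (ℕ × ℕ)} (hf : PolyTime f)
    (hg : PolyTime g) (hh : PolyTime h) : PolyTime fun x => final (f x) (g x) (h x) := by
  have := polyTime_final.comp (hf.prodMk (hg.prodMk hh))
  exact this

@[fun_prop]
theorem polyTime_core {f : α → ℕ} {h : α → List (ℕ × ℕ)} (hf : PolyTime f)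
    (hh : PolyTime h) : PolyTime fun x => core (f x) (h x) := by
  unfold core
  exact PolyTime.filter (p := fun x (e : ℕ × ℕ) =>
    Nat.ble (f x + 1) (outDeg (h x) e.1 + inDeg (h x) e.1) &&
      Nat.ble (f x + 1) (outDeg (h x) e.2 + inDeg (h x) e.2)) hh (by fun_prop)

theorem polyTime_test {f g : α → ℕ} {h : α → List (ℕ × ℕ)} (hf : PolyTime f) (hg : PolyTime g)
    (hh : PolyTime h) : PolyTime fun x => test (f x) (g x) (h x) := by
  unfold test
  exact PolyTime.all
    (p := fun x (e : ℕ × ℕ) => !Nat.ble (f x) (outDeg (final (f x) (g x) (core (f x) (h x))).1 e.1))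
    (by fun_prop) (by fun_prop)

theorem polyTime_failures :
    PolyTime fun x : ℕ × ℕ × List (ℕ × ℕ) => failures x.1 x.2.2 x.2.1 := by
  refine PolyTime.iterate (f := fun x : ℕ × ℕ × List (ℕ × ℕ) => failuresStep x.1 x.2.2)
    (n := fun x => x.2.1) (i := fun _ => (0, 0))
    (by fun_prop) (by fun_prop) ?_ ⟨4 * .X + 4, fun x k hk => ?_⟩
  · have := polyTime_test (f := fun z : (ℕ × ℕ × List (ℕ × ℕ)) × (ℕ × ℕ) => z.2.1)
      (g := fun z => z.1.1) (h := fun z => z.1.2.2) (by fun_prop) (by fun_prop) (by fun_prop)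
    unfold failuresStep
    exact PolyTime.prodMk (by fun_prop) (PolyTime.ite this (by fun_prop) (by fun_prop))
  · have key : ∀ k, ((failuresStep x.1 x.2.2)^[k] (0, 0)).1 = k ∧
        ((failuresStep x.1 x.2.2)^[k] (0, 0)).2 ≤ k := by
      intro k
      induction k with
      | zero => simp
      | succ k ih =>
        rw [Function.iterate_succ_apply']
        refine ⟨by simp [failuresStep, ih.1], ?_⟩
        simp only [failuresStep]
        split <;> omega
    have h1 := key k
    have h8 : ∀ z : ℕ × ℕ, size z = size z.1 + size z.2 + 1 := fun z => size_pair _ _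
    rw [h8, size_nat, size_nat]
    obtain ⟨a, b, c⟩ := x
    simp at *
    omega

theorem polyTime_readGraph : PolyTime readGraph := by
  have hs : PolyTime fun z : List (Option Bool) × (ℕ × ℕ × List (ℕ × ℕ)) × Option Bool =>
      readStep z.2.1 z.2.2 := by
    -- By definition, `o` and `o.toList` are represented by the same tree.
    have ho : PolyTime fun o : Option Bool => o.toList :=
      (PolyTime.id (α := Option Bool)).of_toTree_eq (e := id) (fun _ => rfl) fun _ => rfl
    have ho' : PolyTime fun z : List (Option Bool) × (ℕ × ℕ × List (ℕ × ℕ)) × Option Bool =>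
      z.2.2.toList := ho.comp (by fun_prop)
    have := PolyTime.listCases ho' (g := fun z => (z.2.1.1 + 1, 0, z.2.1.2.2))
      (h := fun z b _ => (z.2.1.1, z.2.1.2.1 + 1,
        if b && Nat.ble (z.2.1.2.1 + 1) z.2.1.1 then (z.2.1.1, z.2.1.2.1) :: z.2.1.2.2
          else z.2.1.2.2)) (by fun_prop) (PolyTime.prodMk (by fun_prop) (PolyTime.prodMk
            (by fun_prop) (PolyTime.ite (by fun_prop) (by fun_prop) (by fun_prop))))
    convert this using 2 with z
    unfold readStep
    cases z.2.2.toList <;> rfl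
  refine PolyTime.foldl_of_size_le (h := fun _ => readStep) PolyTime.id (by fun_prop) hs
    ⟨4 * .X + 5 + .X * (4 * .X + 4), fun w l hl => ?_⟩
  have key : ∀ l : List (Option Bool), (l.foldl readStep (0, 0, [])).1 ≤ l.length ∧
      (l.foldl readStep (0, 0, [])).2.1 ≤ l.length ∧
      size (l.foldl readStep (0, 0, [])).2.2 ≤ 1 + l.length * (4 * l.length + 4) := by
    intro l
    induction l using List.reverseRecOn with
    | nil => simp
    | append_singleton l o ih =>
      rw [List.foldl_concat]
      generalize l.foldl readStep (0, 0, []) = s at ih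
      obtain ⟨i, j, E⟩ := s
      simp at ih
      rcases o with _ | b
      · simp [readStep]
        refine ⟨ih.1, ih.2.2.trans ?_⟩
        gcongr <;> omega
      · simp only [readStep, Option.toList_some, List.length_append, List.length_singleton]
        refine ⟨by omega, by omega, ?_⟩
        have : 1 + (l.length + 1) * (4 * (l.length + 1) + 4) =
          1 + l.length * (4 * l.length + 4) + (8 * l.length + 8) := by ring
        rw [this]
        split
        · simp
          omega
        · omega
  obtain ⟨h1, h2, h3⟩ := key l
  have h4 := hl.length_le.trans (length_le_size w)
  have h5 : l.length * (4 * l.length + 4) ≤ size w * (4 * size w + 4) := by gcongr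
  have h8 : ∀ z : ℕ × ℕ × List (ℕ × ℕ), size z = size z.1 + (size z.2.1 + size z.2.2 + 1) + 1 :=
    fun z => by obtain ⟨a, b, c⟩ := z; simp
  rw [h8, size_nat, size_nat]
  simp
  omega

theorem polyTime_algorithm : PolyTime fun w => Computability.encodeNat (algorithm w) := by
  have h1 : PolyTime fun w => readGraph w := polyTime_readGraph
  have h2 := polyTime_failures.comp
    (by fun_prop : PolyTime fun w => ((readGraph w).1, (readGraph w).1, (readGraph w).2.2))
  exact PolyTime.encodeNat (PolyTime.snd h2)

end StarArboricity

/-! ### Correctness of the push-relabel algorithm -/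

namespace StarArboricity

theorem outDeg_cons (e : ℕ × ℕ) (E : List (ℕ × ℕ)) (v : ℕ) :
    outDeg (e :: E) v = outDeg E v + if e.1 = v then 1 else 0 := by
  simp [outDeg, List.countP_cons]

theorem outDeg_perm {E E' : List (ℕ × ℕ)} (h : E.Perm E') (v : ℕ) : outDeg E v = outDeg E' v :=
  h.countP_eq _

theorem height_cons (w : ℕ) (L : List ℕ) (v : ℕ) :
    height (w :: L) v = height L v + if w = v then 1 else 0 := by
  simp [height, List.countP_cons]

theorem mem_of_height_pos {L : List ℕ} {v : ℕ} (h : 0 < height L v) : v ∈ L := by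
  obtain ⟨w, hw, hv⟩ := List.countP_pos_iff.1 h
  rw [Nat.beq_eq] at hv
  exact hv ▸ hw

/-- One step of the algorithm reverses an admissible edge, or lifts a vertex while there is no
admissible edge, or does nothing because there is neither an admissible nor a liftable edge. -/
theorem step_cases (k n : ℕ) (s : State) :
    (∃ e r, s.1.Perm (e :: r) ∧ admissible k s e = true ∧
      (step k n s).1.Perm ((e.2, e.1) :: r) ∧ (step k n s).2 = s.2) ∨
    ((∀ e ∈ s.1, ¬ admissible k s e = true) ∧ ∃ e ∈ s.1, liftable k n s e = true ∧
      step k n s = (s.1, e.1 :: s.2)) ∨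
    ((∀ e ∈ s.1, ¬ liftable k n s e = true) ∧ step k n s = s) := by
  unfold step
  split
  · next e r h =>
    refine Or.inl ⟨e, r ++ s.1.filter fun e => !admissible k s e, ?_, ?_, .rfl, rfl⟩
    · have := List.filter_append_perm (admissible k s) s.1
      rw [h] at this
      exact this.symm
    · exact (List.mem_filter.1 (h ▸ List.mem_cons_self : e ∈ s.1.filter (admissible k s))).2
  · next h =>
    rw [List.filter_eq_nil_iff] at h
    split
    · next e r h' =>
      have := List.mem_filter.1 (h' ▸ List.mem_cons_self : e ∈ s.1.filter (liftable k n s))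
      exact Or.inr (Or.inl ⟨h, e, this.1, this.2, rfl⟩)
    · next h' =>
      rw [List.filter_eq_nil_iff] at h'
      exact Or.inr (Or.inr ⟨h', rfl⟩)

/-- The invariant of the push-relabel algorithm, started with the edges `E₀`. -/
structure Invariant (k n : ℕ) (E₀ : List (ℕ × ℕ)) (s : State) : Prop where
  /-- the edges are those of `E₀`, up to their directions -/
  perm : (s.1.map fun e => s(e.1, e.2)).Perm (E₀.map fun e => s(e.1, e.2))
  /-- an edge leads down by at most one level -/
  steep : ∀ e ∈ s.1, height s.2 e.1 ≤ height s.2 e.2 + 1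
  /-- a vertex that has been lifted has out-degree at least `k - 1` -/
  le_outDeg : ∀ v, 0 < height s.2 v → k ≤ outDeg s.1 v + 1
  /-- only vertices of the graph have been lifted -/
  lt : ∀ v ∈ s.2, v < n
  /-- no vertex is higher than `n + 1`, as vertices are lifted only from heights at most `n` -/
  height_le : ∀ v, height s.2 v ≤ n + 1

namespace Invariant

variable {k n : ℕ} {E₀ : List (ℕ × ℕ)} {s : State}

theorem init (k n : ℕ) (E₀ : List (ℕ × ℕ)) : Invariant k n E₀ (E₀, []) where
  perm := .rfl
  steep := by simp [height]
  le_outDeg := by simp [height]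
  lt := by simp
  height_le := by simp [height]

theorem mem_or (hs : Invariant k n E₀ s) {e : ℕ × ℕ} (he : e ∈ s.1) :
    e ∈ E₀ ∨ (e.2, e.1) ∈ E₀ := by
  have := hs.perm.subset (List.mem_map_of_mem he)
  obtain ⟨f, hf, hfe⟩ := List.mem_map.1 this
  rcases Sym2.eq_iff.1 hfe with ⟨h1, h2⟩ | ⟨h1, h2⟩
  · exact Or.inl (by rwa [← show f = e from Prod.ext h1 h2])
  · exact Or.inr (by rwa [← show f = (e.2, e.1) from Prod.ext h1 h2])

theorem mem_or' (hs : Invariant k n E₀ s) {e : ℕ × ℕ} (he : e ∈ E₀) :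
    e ∈ s.1 ∨ (e.2, e.1) ∈ s.1 := by
  have := hs.perm.symm.subset (List.mem_map_of_mem he)
  obtain ⟨f, hf, hfe⟩ := List.mem_map.1 this
  rcases Sym2.eq_iff.1 hfe with ⟨h1, h2⟩ | ⟨h1, h2⟩
  · exact Or.inl (by rwa [← show f = e from Prod.ext h1 h2])
  · exact Or.inr (by rwa [← show f = (e.2, e.1) from Prod.ext h1 h2])

theorem step (hs : Invariant k n E₀ s) (hE : ∀ e ∈ E₀, e.1 < n ∧ e.2 < n) :
    Invariant k n E₀ (step k n s) := by
  rcases step_cases k n s with ⟨e, r, hp, ha, hp', h2⟩ | ⟨hna, e, he, hl, hstep⟩ | ⟨-, hstep⟩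
  · simp only [admissible, Bool.and_eq_true, Nat.ble_eq, Nat.beq_eq] at ha
    refine ⟨?_, fun f hf => ?_, fun v hv => ?_, by rw [h2]; exact hs.lt,
      by rw [h2]; exact hs.height_le⟩
    · refine ((hp'.map _).trans ?_).trans hs.perm
      refine List.Perm.trans ?_ (hp.map _).symm
      simp [Sym2.eq_swap]
    · rw [h2]
      rcases List.mem_cons.1 (hp'.subset hf) with rfl | hf
      · simp only
        omega
      · exact hs.steep f (hp.symm.subset (List.mem_cons_of_mem _ hf))
    · rw [h2] at hv
      have h1 := hs.le_outDeg v hv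
      have h3 := ha.1
      rw [outDeg_perm hp, outDeg_cons] at h1 h3
      rw [outDeg_perm hp', outDeg_cons]
      by_cases h : e.1 = v
      · subst h
        simp at h3
        omega
      · simp only [h, if_false] at h1
        omega
  · rw [hstep]
    simp only [liftable, Bool.and_eq_true, Nat.ble_eq] at hl
    refine ⟨hs.perm, fun f hf => ?_, fun v hv => ?_, fun v hv => ?_, fun v => ?_⟩
    · have h1 := hs.steep f hf
      have h2 := hna f hf
      simp only [admissible, Bool.and_eq_true, Nat.ble_eq, Nat.beq_eq, not_and] at h2
      simp only [height_cons]
      by_cases h : e.1 = f.1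
      · rw [h] at hl
        have := h2 hl.1
        simp only [h, if_true]
        omega
      · simp only [h, if_false]
        omega
    · simp only [height_cons] at hv
      by_cases h : e.1 = v
      · subst h
        exact hl.1.trans (Nat.le_succ _)
      · simp only [h, if_false] at hv
        exact hs.le_outDeg v hv
    · rcases List.mem_cons.1 hv with rfl | hv
      · rcases hs.mem_or he with h | h
        · exact (hE _ h).1
        · exact (hE _ h).2
      · exact hs.lt v hv
    · simp only [height_cons]
      have := hs.height_le v
      by_cases h : e.1 = v
      · subst h
        simp
        omega
      · simp only [h, if_false]
        omega
  · rwa [hstep]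

theorem iterate (hs : Invariant k n E₀ s) (hE : ∀ e ∈ E₀, e.1 < n ∧ e.2 < n) (t : ℕ) :
    Invariant k n E₀ ((StarArboricity.step k n)^[t] s) := by
  induction t with
  | zero => exact hs
  | succ t ih =>
    rw [Function.iterate_succ_apply']
    exact ih.step hE

theorem length_le (hs : Invariant k n E₀ s) : s.2.length ≤ n * (n + 1) := by
  have h : ∀ L : List ℕ, (∀ v ∈ L, v < n) → L.length = ∑ v ∈ Finset.range n, height L v := by
    intro L hL
    induction L with
    | nil => simp [height]
    | cons w L ih =>
      have hw := hL w List.mem_cons_self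
      simp only [height_cons, Finset.sum_add_distrib,
        ← ih fun v hv => hL v (List.mem_cons_of_mem _ hv)]
      simp [hw]
  rw [h _ hs.lt]
  exact (Finset.sum_le_card_nsmul _ _ _ fun v _ => hs.height_le v).trans (by simp)

end Invariant

/-- The potential that decreases in every step of the algorithm: an edge is reversed only from a
tail to a lower head, and lifting a vertex increases the first summand at most by the number of
edges. -/
def potential (n : ℕ) (E₀ : List (ℕ × ℕ)) (s : State) : ℕ :=
  (s.1.map fun e => height s.2 e.1).sum + (E₀.length + 1) * (n * (n + 1) - s.2.length)

theorem potential_step_lt {k n : ℕ} {E₀ : List (ℕ × ℕ)} {s : State} (hs : Invariant k n E₀ s)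
    (hE : ∀ e ∈ E₀, e.1 < n ∧ e.2 < n) :
    potential n E₀ (step k n s) < potential n E₀ s ∨
      ((∀ e ∈ s.1, ¬ liftable k n s e = true) ∧ step k n s = s) := by
  rcases step_cases k n s with ⟨e, r, hp, ha, hp', h2⟩ | ⟨hna, e, he, hl, hstep⟩ | h
  · left
    simp only [admissible, Bool.and_eq_true, Nat.ble_eq, Nat.beq_eq] at ha
    unfold potential
    rw [h2, (hp.map _).sum_eq, (hp'.map _).sum_eq]
    simp only [List.map_cons, List.sum_cons]
    omega
  · left
    have hlen := (hs.step hE).length_le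
    have hperm := hs.perm.length_eq
    rw [List.length_map, List.length_map] at hperm
    rw [hstep] at hlen ⊢
    have key : ∀ E : List (ℕ × ℕ), (E.map fun f => height (e.1 :: s.2) f.1).sum =
        (E.map fun f => height s.2 f.1).sum + outDeg E e.1 := by
      intro E
      induction E with
      | nil => rfl
      | cons f E ih =>
        simp only [List.map_cons, List.sum_cons, ih, outDeg_cons]
        rw [height_cons]
        simp only [eq_comm (a := e.1)]
        omega
    have hout : outDeg s.1 e.1 ≤ E₀.length := hperm ▸ List.countP_le_length
    simp only [potential, key, List.length_cons] at hlen ⊢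
    obtain ⟨d, hd⟩ := Nat.exists_eq_add_of_le hlen
    rw [hd, show s.2.length + 1 + d - (s.2.length + 1) = d by omega,
      show s.2.length + 1 + d - s.2.length = d + 1 by omega, Nat.mul_succ]
    omega
  · exact Or.inr h

theorem not_liftable_iterate {k n : ℕ} {E₀ : List (ℕ × ℕ)} (hE : ∀ e ∈ E₀, e.1 < n ∧ e.2 < n)
    (t : ℕ) {s : State} (hs : Invariant k n E₀ s) (ht : potential n E₀ s ≤ t) :
    ∀ e ∈ ((step k n)^[t] s).1, ¬ liftable k n ((step k n)^[t] s) e = true := by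
  induction t generalizing s with
  | zero =>
    rcases potential_step_lt hs hE with h | h
    · omega
    · exact h.1
  | succ t ih =>
    rcases potential_step_lt hs hE with h | h
    · rw [Function.iterate_succ_apply]
      exact ih (hs.step hE) (by omega)
    · rw [Function.iterate_fixed h.2]
      exact h.1

theorem invariant_final {n : ℕ} {E₀ : List (ℕ × ℕ)} (k : ℕ) (hE : ∀ e ∈ E₀, e.1 < n ∧ e.2 < n) :
    Invariant k n E₀ (final k n E₀) := (Invariant.init k n E₀).iterate hE _

theorem not_liftable_final {n : ℕ} {E₀ : List (ℕ × ℕ)} (k : ℕ)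
    (hE : ∀ e ∈ E₀, e.1 < n ∧ e.2 < n) :
    ∀ e ∈ (final k n E₀).1, ¬ liftable k n (final k n E₀) e = true := by
  refine not_liftable_iterate hE _ (Invariant.init k n E₀) ?_
  have : ∀ E : List (ℕ × ℕ), (E.map fun f => height [] f.1).sum = 0 := by
    intro E
    induction E with
    | nil => rfl
    | cons f E ih => simp [height]
  simp [potential, fuel, this]

theorem sum_outDeg (S : Finset ℕ) (E : List (ℕ × ℕ)) :
    ∑ v ∈ S, outDeg E v = (E.filter fun e => decide (e.1 ∈ S)).length := by
  induction E with
  | nil => simp [outDeg]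
  | cons e E ih =>
    simp only [outDeg_cons, Finset.sum_add_distrib, ih, Finset.sum_ite_eq, List.filter_cons]
    by_cases h : e.1 ∈ S <;> simp [h]

/-- If the algorithm is stuck with an excess vertex, then every orientation `D` has a vertex of
out-degree at least `k`. Indeed, as there are only `n` vertices, some level `g` between `1` and `n`
is empty. No edge leaves the set `S` of the vertices above `g`, so the number of edges inside `S` is
the sum of the out-degrees, which exceeds `(k - 1) * #S`. -/
theorem exists_le_card_of_stuck {k n : ℕ} {E₀ : List (ℕ × ℕ)} {s : State}
    (hs : Invariant k n E₀ s) (hE : ∀ e ∈ E₀, e.1 < n ∧ e.2 < n)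
    (hnd : (E₀.map fun e => s(e.1, e.2)).Nodup)
    (hl : ∀ e ∈ s.1, ¬ liftable k n s e = true) {e₀ : ℕ × ℕ} (he₀ : e₀ ∈ s.1)
    (hk : k ≤ outDeg s.1 e₀.1) (D : ℕ → ℕ → Prop) [∀ u v, Decidable (D u v)]
    (hD : ∀ e ∈ E₀, D e.1 e.2 ∨ D e.2 e.1) :
    ∃ e ∈ E₀, k ≤ ((Finset.range n).filter (D e.1)).card ∨
      k ≤ ((Finset.range n).filter (D e.2)).card := by
  by_contra! hcon
  have hvert : ∀ e ∈ s.1, ((Finset.range n).filter (D e.1)).card < k ∧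
      ((Finset.range n).filter (D e.2)).card < k := by
    intro e he
    rcases hs.mem_or he with h | h
    · exact hcon _ h
    · exact (hcon _ h).symm
  have hD' : ∀ e ∈ s.1, D e.1 e.2 ∨ D e.2 e.1 := by
    intro e he
    rcases hs.mem_or he with h | h
    · exact hD _ h
    · exact (hD _ h).symm
  have hlt : ∀ e ∈ s.1, e.1 < n ∧ e.2 < n := by
    intro e he
    rcases hs.mem_or he with h | h
    · exact hE _ h
    · exact (hE _ h).symm
  have hk0 : 0 < k := (Nat.zero_le _).trans_lt (hvert e₀ he₀).1
  have htop : n + 1 ≤ height s.2 e₀.1 := by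
    have := hl e₀ he₀
    simp only [liftable, Bool.and_eq_true, Nat.ble_eq, not_and, not_le] at this
    exact this hk
  have hlow : ∀ v, 0 < height s.2 v → v < n := fun v hv => hs.lt v (mem_of_height_pos hv)
  obtain ⟨g, hg1, hgn, hg⟩ : ∃ g, 1 ≤ g ∧ g ≤ n ∧ ∀ v, height s.2 v ≠ g := by
    by_contra! hno
    have hsub : Finset.Icc 1 (n + 1) ⊆ (Finset.range n).image (height s.2) := by
      intro g hg
      rw [Finset.mem_Icc] at hg
      obtain ⟨v, hv⟩ : ∃ v, height s.2 v = g := by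
        rcases hg.2.lt_or_eq with h | rfl
        · exact hno g hg.1 (by omega)
        · exact ⟨e₀.1, (hs.height_le _).antisymm htop⟩
      exact Finset.mem_image.2 ⟨v, Finset.mem_range.2 (hlow v (by omega)), hv⟩
    have := (Finset.card_le_card hsub).trans Finset.card_image_le
    simp at this
  set S := (Finset.range n).filter fun v => g < height s.2 v with hS
  have hmem : ∀ v, v ∈ S ↔ g < height s.2 v := by
    intro v
    rw [hS, Finset.mem_filter, Finset.mem_range]
    exact ⟨fun h => h.2, fun h => ⟨hlow v (by omega), h⟩⟩
  set T := s.1.filter fun e => decide (e.1 ∈ S) with hT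
  have hTS : ∀ e ∈ T, e ∈ s.1 ∧ e.1 ∈ S ∧ e.2 ∈ S := by
    intro e he
    rw [hT, List.mem_filter, decide_eq_true_iff] at he
    refine ⟨he.1, he.2, ?_⟩
    have h1 := hs.steep e he.1
    have h2 := hg e.2
    have h3 := (hmem _).1 he.2
    rw [hmem]
    omega
  have hlower : S.card * (k - 1) < T.length := by
    rw [hT, ← sum_outDeg, ← smul_eq_mul, ← Finset.sum_const]
    have h0 : e₀.1 ∈ S := (hmem _).2 (by omega)
    refine Finset.sum_lt_sum (fun v hv => ?_) ⟨e₀.1, h0, by omega⟩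
    have := hs.le_outDeg v (by have := (hmem v).1 hv; omega)
    omega
  -- `φ` directs an edge according to `D`, and collects the heads by their tails.
  let φ : ℕ × ℕ → (_ : ℕ) × ℕ := fun e => if D e.1 e.2 then ⟨e.1, e.2⟩ else ⟨e.2, e.1⟩
  have hφ : ∀ e, s((φ e).1, (φ e).2) = s(e.1, e.2) := by
    intro e
    by_cases h : D e.1 e.2
    · simp [φ, h]
    · simp [φ, h, Sym2.eq_swap]
  have hnodup : (T.map φ).Nodup := by
    refine List.Nodup.of_map (fun p : (_ : ℕ) × ℕ => s(p.1, p.2)) ?_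
    rw [List.map_map]
    have : (fun p : (_ : ℕ) × ℕ => s(p.1, p.2)) ∘ φ = fun e => s(e.1, e.2) := funext hφ
    rw [this]
    exact (hs.perm.nodup_iff.2 hnd).sublist (List.filter_sublist.map _)
  -- The out-degree in `D` is bounded only for the ends of edges.
  set S' := S.filter fun v => ∃ e ∈ s.1, e.1 = v ∨ e.2 = v with hS'
  have hsub : (T.map φ).toFinset ⊆ S'.sigma fun v => (Finset.range n).filter (D v) := by
    intro p hp
    obtain ⟨e, he, rfl⟩ := List.mem_map.1 (List.mem_toFinset.1 hp)
    obtain ⟨he, h1, h2⟩ := hTS e he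
    by_cases h : D e.1 e.2
    · have : φ e = ⟨e.1, e.2⟩ := if_pos h
      rw [this]
      exact Finset.mem_sigma.2 ⟨Finset.mem_filter.2 ⟨h1, e, he, Or.inl rfl⟩,
        Finset.mem_filter.2 ⟨Finset.mem_range.2 (hlt e he).2, h⟩⟩
    · have : φ e = ⟨e.2, e.1⟩ := if_neg h
      rw [this]
      exact Finset.mem_sigma.2 ⟨Finset.mem_filter.2 ⟨h2, e, he, Or.inr rfl⟩,
        Finset.mem_filter.2 ⟨Finset.mem_range.2 (hlt e he).1, (hD' e he).resolve_left h⟩⟩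
  have hupper : T.length ≤ S'.card * (k - 1) := by
    have h1 := Finset.card_le_card hsub
    rw [List.toFinset_card_of_nodup hnodup, List.length_map, Finset.card_sigma] at h1
    refine h1.trans (Finset.sum_le_card_nsmul _ _ _ fun v hv => ?_)
    obtain ⟨-, e, he, rfl | rfl⟩ := Finset.mem_filter.1 hv
    · have := (hvert e he).1
      omega
    · have := (hvert e he).2
      omega
  have hcard : S'.card ≤ S.card := Finset.card_filter_le _ _
  have := Nat.mul_le_mul_right (k - 1) hcard
  omega

end StarArboricity

/-! ### Star forests and orientations -/

namespace StarArboricity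

open GraphCover SimpleGraph

/-- A graph all of whose edges have a common end is a star forest. The common end, if there is one,
is the vertex that satisfies `p`. -/
theorem isStarForest_of_center {W : Type*} {T : SimpleGraph W} (p : W → Prop)
    (hp : ∀ a b, p a → p b → a = b) (hT : ∀ a b, T.Adj a b → p a ∨ p b) : IsStarForest T := by
  refine ⟨fun u w hw => ?_, fun u v w hw h3 => ?_⟩
  · have hlen := hw.three_le_length
    have hnd := hw.support_nodup
    match w, hlen with
    | .cons (v := a) h1 (.cons (v := b) h2 (.cons (v := c) h3 r)), _ =>
      simp only [Walk.support_cons, List.tail_cons, List.nodup_cons, List.mem_cons, not_or] at hnd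
      have hc := r.start_mem_support
      have hu := r.end_mem_support
      have := h1.ne
      rcases hT _ _ h2 with ha | hb
      · rcases hT _ _ h3 with hb | hc'
        · exact hnd.1.1 (hp _ _ ha hb)
        · exact hnd.1.2 (hp _ _ ha hc' ▸ hc)
      · rcases hT _ _ h1 with hu' | ha
        · exact hnd.2.1 (hp _ _ hu' hb ▸ hu)
        · exact hnd.1.1 (hp _ _ ha hb)
  · match w, h3 with
    | .cons (v := a) h1 (.cons (v := b) h2 (.cons (v := c) h3 .nil)), _ =>
      have hnd := hw.support_nodup
      simp only [Walk.support_cons, Walk.support_nil, List.nodup_cons, List.mem_cons,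
        List.not_mem_nil, or_false, not_or] at hnd
      rcases hT _ _ h1 with hu | ha
      · rcases hT _ _ h3 with hb | hc
        · exact hnd.1.2.1 (hp _ _ hu hb)
        · exact hnd.1.2.2 (hp _ _ hu hc)
      · rcases hT _ _ h3 with hb | hc
        · exact hnd.2.1.1 (hp _ _ ha hb)
        · exact hnd.2.1.2 (hp _ _ ha hc)

/-- One end of every edge of a star forest is a leaf. -/
theorem leaf_or_leaf {W : Type*} {T : SimpleGraph W} (hT : IsStarForest T) {x y : W}
    (hxy : T.Adj x y) : (∀ z, T.Adj x z → z = y) ∨ ∀ z, T.Adj y z → z = x := by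
  by_contra! h
  obtain ⟨⟨a, hxa, hay⟩, b, hyb, hbx⟩ := h
  by_cases hab : a = b
  · subst hab
    refine hT.1 (.cons hxy (.cons hyb (.cons hxa.symm .nil))) ?_
    have := hxy.ne'
    have := hxy.ne
    have := hyb.ne
    have := hxa.ne
    simp_all [Walk.isCycle_def, Walk.isTrail_def]
  · refine hT.2 a b (.cons hxa.symm (.cons hxy (.cons hyb .nil))) ?_ rfl
    have := hxy.ne
    have := hyb.ne
    have := hxa.ne
    simp_all [Walk.isPath_def, eq_comm]

variable {n : ℕ} {G : SimpleGraph (Fin n)}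

theorem localStarArboricity_le_iff_exists_cover {k : ℕ} : localStarArboricity G ≤ k ↔
    ∃ φ : Cover starForests G, φ.IsInjective ∧ ∀ v, (φ.toFun ⁻¹' {v}).encard ≤ k := by
  rw [← Nat.cast_le (α := ℕ∞), coe_localStarArboricity, localCoveringNumber,
    ← ENat.lt_add_one_iff (ENat.natCast_ne_top k)]
  simp only [iInf_lt_iff]
  simp only [ENat.lt_add_one_iff (ENat.natCast_ne_top k), Cover.maxPreimages,
    iSup_le_iff, exists_prop]

/-- `D` orients every edge of `G` in at least one direction, and the vertices of degree more
than `k` have out-degree less than `k`. Edges may be oriented in both directions, and `D` may relate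
vertices that are not adjacent: both can only increase the out-degrees. -/
structure IsGoodOrientation (G : SimpleGraph (Fin n)) (k : ℕ) (D : Fin n → Fin n → Prop) :
    Prop where
  total : ∀ u v, G.Adj u v → D u v ∨ D v u
  ncard_lt : ∀ u, k < (G.neighborSet u).ncard → {v | D u v}.ncard < k

/-- Orient every edge of the cover from a leaf to the centre of its star. If a vertex `u` has
out-degree at least `k`, then all its preimages are leaves whose edges are oriented out of `u`, so
that no further edge is covered at `u`. -/
theorem exists_isGoodOrientation_of_cover {k : ℕ} (φ : Cover starForests G)
    (hk : ∀ v, (φ.toFun ⁻¹' {v}).encard ≤ k) : ∃ D, IsGoodOrientation G k D := by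
  refine ⟨fun u v => ∃ i x y, (φ.template i).Adj x y ∧ (∀ z, (φ.template i).Adj x z → z = y) ∧
    φ.hom i x = u ∧ φ.hom i y = v, ?_, ?_⟩
  · intro u v huv
    obtain ⟨i, x, y, hxy, rfl, rfl⟩ := φ.edge_surjective u v huv
    rcases leaf_or_leaf (φ.template_mem i) hxy with h | h
    · exact Or.inl ⟨i, x, y, hxy, h, rfl, rfl⟩
    · exact Or.inr ⟨i, y, x, hxy.symm, h, rfl, rfl⟩
  · intro u hdeg
    by_contra! hle
    set Out := {v | ∃ i x y, (φ.template i).Adj x y ∧ (∀ z, (φ.template i).Adj x z → z = y) ∧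
      φ.hom i x = u ∧ φ.hom i y = v} with hOut
    choose i x y hxy hleaf hx hy using fun v : Out => v.2
    have hfin : (φ.toFun ⁻¹' {u}).Finite := Set.finite_of_encard_le_coe (hk u)
    have hcard : (φ.toFun ⁻¹' {u}).ncard ≤ k := by
      have := hk u
      rw [← hfin.cast_ncard_eq] at this
      exact_mod_cast this
    let g : Out → φ.toFun ⁻¹' {u} := fun v => ⟨⟨i v, x v⟩, hx v⟩
    have hg : Function.Injective g := by
      intro v w hvw
      have h1 : (⟨i v, x v⟩ : Σ i : Fin φ.size, Fin (φ.order i)) = ⟨i w, x w⟩ :=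
        congrArg Subtype.val hvw
      have key : ∀ (p q : Σ i : Fin φ.size, Fin (φ.order i)) (a : Fin (φ.order p.1))
          (b : Fin (φ.order q.1)), p = q → (φ.template p.1).Adj p.2 a →
          (∀ z, (φ.template q.1).Adj q.2 z → z = b) → φ.hom p.1 a = φ.hom q.1 b := by
        rintro p q a b rfl h1 h2
        rw [h2 a h1]
      have := key _ _ (y v) (y w) h1 (hxy v) (hleaf w)
      rw [hy v, hy w] at this
      exact Subtype.ext this
    have : Finite (φ.toFun ⁻¹' {u}) := hfin.to_subtype
    have hbij := hg.bijective_of_nat_card_le (show Nat.card (φ.toFun ⁻¹' {u}) ≤ Nat.card Out from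
      hcard.trans hle)
    have hOutle : Out.ncard ≤ (φ.toFun ⁻¹' {u}).ncard := Nat.card_le_card_of_injective g hg
    obtain ⟨w, hw, hwOut⟩ := Set.exists_mem_notMem_of_ncard_lt_ncard
      (hOutle.trans_lt (hcard.trans_lt hdeg))
    obtain ⟨j, b, a, hba, hb, ha⟩ := φ.edge_surjective u w hw
    rcases leaf_or_leaf (φ.template_mem j) hba with h | h
    · exact hwOut ⟨j, b, a, hba, h, hb, ha⟩
    · obtain ⟨v, hv⟩ := hbij.2 ⟨⟨j, b⟩, hb⟩
      have h1 : (⟨i v, x v⟩ : Σ i : Fin φ.size, Fin (φ.order i)) = ⟨j, b⟩ :=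
        congrArg Subtype.val hv
      have key : ∀ (p q : Σ i : Fin φ.size, Fin (φ.order i)) (c : Fin (φ.order p.1))
          (a : Fin (φ.order q.1)), p = q → (∀ z, (φ.template p.1).Adj p.2 z → z = c) →
          (φ.template q.1).Adj q.2 a → φ.hom p.1 c = φ.hom q.1 a := by
        rintro p q c a rfl h1 h2
        rw [h1 a h2]
      have := key _ _ (y v) a h1 (hleaf v) hba
      rw [hy v, ha] at this
      exact hwOut (this ▸ v.2)

/-- The vertices of the star with centre `v` and leaves `{u | D u v}`; the star is empty if it has
no leaves. -/
def starSet (D : Fin n → Fin n → Prop) (v : Fin n) : Set (Fin n) :=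
  {x | (x = v ∧ ∃ u, D u v) ∨ D x v}

/-- A numbering of the vertices of a star. -/
noncomputable def starEquiv (D : Fin n → Fin n → Prop) (v : Fin n) :
    Fin (Nat.card (starSet D v)) ≃ starSet D v := (Finite.equivFin _).symm

/-- The cover of `G` by the stars with centres `v` and leaves `{u | D u v}`. -/
noncomputable def starCover (D : Fin n → Fin n → Prop) (hD : ∀ u v, D u v → G.Adj u v)
    (htot : ∀ u v, G.Adj u v → D u v ∨ D v u) : Cover starForests G where
  size := n
  order v := Nat.card (starSet D v)
  template v :=
    { Adj := fun a b => ((starEquiv D v a : Fin n) = v ∧ D (starEquiv D v b) v) ∨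
        ((starEquiv D v b : Fin n) = v ∧ D (starEquiv D v a) v)
      symm := ⟨fun _ _ h => h.symm⟩
      loopless := ⟨fun a h => by
        have h' : (starEquiv D v a : Fin n) = v ∧ D (starEquiv D v a) v := h.elim id id
        exact (hD _ _ h'.2).ne h'.1⟩ }
  template_mem v := isStarForest_of_center (fun a => (starEquiv D v a : Fin n) = v)
    (fun a b ha hb => (starEquiv D v).injective (Subtype.ext (ha.trans hb.symm)))
    fun a b h => h.imp And.left And.left
  hom v :=
    { toFun := fun a => starEquiv D v a
      map_rel' := by
        rintro a b (⟨h1, h2⟩ | ⟨h1, h2⟩)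
        · rw [h1]
          exact (hD _ _ h2).symm
        · rw [h1]
          exact hD _ _ h2 }
  edge_surjective u v huv := by
    have key : ∀ {v : Fin n} (x : starSet D v),
        (starEquiv D v ((starEquiv D v).symm x) : Fin n) = x := fun x =>
      congrArg Subtype.val (Equiv.apply_symm_apply _ x)
    rcases htot u v huv with h | h
    · refine ⟨v, (starEquiv D v).symm ⟨u, Or.inr h⟩, (starEquiv D v).symm ⟨v, Or.inl ⟨rfl, u, h⟩⟩,
        Or.inr ⟨key _, ?_⟩, key _, key _⟩
      rw [key]
      exact h
    · refine ⟨u, (starEquiv D u).symm ⟨u, Or.inl ⟨rfl, v, h⟩⟩, (starEquiv D u).symm ⟨v, Or.inr h⟩,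
        Or.inl ⟨key _, ?_⟩, key _, key _⟩
      rw [key]
      exact h

theorem exists_cover_of_isGoodOrientation {k : ℕ} {D : Fin n → Fin n → Prop}
    (hD : IsGoodOrientation G k D) :
    ∃ φ : Cover starForests G, φ.IsInjective ∧ ∀ v, (φ.toFun ⁻¹' {v}).encard ≤ k := by
  -- Every edge is to be oriented in exactly one direction.
  set D' : Fin n → Fin n → Prop := fun u v => G.Adj u v ∧ D u v ∧ (¬ D v u ∨ u < v) with hD'
  have hadj : ∀ u v, D' u v → G.Adj u v := fun u v h => h.1
  have htot : ∀ u v, G.Adj u v → D' u v ∨ D' v u := by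
    intro u v huv
    have h1 := hD.total u v huv
    have h2 := huv.symm
    have h3 := lt_or_gt_of_ne huv.ne
    simp only [hD']
    tauto
  have hanti : ∀ u v, D' u v → ¬ D' v u := by
    rintro u v ⟨-, h1, h2⟩ ⟨-, h3, h4⟩
    exact lt_asymm (h2.resolve_left (not_not.2 h3)) (h4.resolve_left (not_not.2 h1))
  refine ⟨starCover D' hadj htot, fun v a b hab => (starEquiv D' v).injective (Subtype.ext hab),
    fun u => ?_⟩
  have hsub : {v | u ∈ starSet D' v}.ncard ≤ k := by
    have h1 : {v | D' u v} ⊆ G.neighborSet u := fun v hv => hv.1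
    have h2 : {v | D' u v} ⊆ {v | D u v} := fun v hv => hv.2.1
    have h3 := Set.ncard_le_ncard h1
    have h4 := Set.ncard_le_ncard h2
    have h5 := hD.ncard_lt u
    by_cases hin : ∃ w, D' w u
    · obtain ⟨w, hw⟩ := hin
      have h6 : {v | u ∈ starSet D' v} ⊆ insert u {v | D' u v} := by
        rintro v (⟨rfl, -⟩ | hv)
        · exact Or.inl rfl
        · exact Or.inr hv
      have h7 := (Set.ncard_le_ncard h6).trans (Set.ncard_insert_le _ _)
      have h8 : {v | D' u v}.ncard < (G.neighborSet u).ncard := by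
        refine Set.ncard_lt_ncard ⟨h1, fun h => ?_⟩
        exact hanti _ _ hw (h (hw.1.symm : w ∈ G.neighborSet u))
      omega
    · have h6 : {v | u ∈ starSet D' v} ⊆ {v | D' u v} := by
        rintro v (⟨rfl, hv⟩ | hv)
        · exact absurd hv hin
        · exact hv
      have h7 := Set.ncard_le_ncard h6
      omega
  refine le_trans ?_ (Nat.cast_le.2 hsub)
  rw [(Set.toFinite _).cast_ncard_eq]
  refine Set.encard_le_encard_of_injOn (f := Sigma.fst) ?_ ?_
  · rintro ⟨v, a⟩ ha
    have ha' : (starEquiv D' v a : Fin n) = u := ha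
    have h := (starEquiv D' v a).2
    rw [ha'] at h
    exact h
  · rintro ⟨v, a⟩ ha ⟨w, b⟩ hb hvw
    obtain rfl : v = w := hvw
    have ha' : (starEquiv D' v a : Fin n) = u := ha
    have hb' : (starEquiv D' v b : Fin n) = u := hb
    rw [(starEquiv D' v).injective (Subtype.ext (ha'.trans hb'.symm))]

/-- A vertex whose out-degree in an orientation is less than `k` may be the centre of a star in
addition to the stars of which it is a leaf. A vertex of degree at most `k` need not be constrained:
it is a leaf of `k` stars only if all its edges are oriented outwards, and then it is no centre. -/
theorem localStarArboricity_le_iff {k : ℕ} :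
    localStarArboricity G ≤ k ↔ ∃ D, IsGoodOrientation G k D := by
  rw [localStarArboricity_le_iff_exists_cover]
  exact ⟨fun ⟨φ, _, hk⟩ => exists_isGoodOrientation_of_cover φ hk,
    fun ⟨D, hD⟩ => exists_cover_of_isGoodOrientation hD⟩

end StarArboricity

/-! ### Reading the adjacency matrix -/

namespace StarArboricity

open GraphCover

variable {n : ℕ} (G : SimpleGraph (Fin n))

open Classical in
/-- The adjacency matrix of a graph, with indices in `ℕ`. -/
noncomputable def adjBit (i j : ℕ) : Bool :=
  decide (∃ (hi : i < n) (hj : j < n), G.Adj ⟨i, hi⟩ ⟨j, hj⟩)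

/-- The edges `(i, j)` of `G` with `j < i < m`, in the order in which they are found. -/
noncomputable def edges : ℕ → List (ℕ × ℕ)
  | 0 => []
  | m + 1 => ((List.range n).filter fun j => adjBit G m j && Nat.ble (j + 1) m).reverse.map
      (fun j => (m, j)) ++ edges m

variable {G}

theorem map_val_finRange (n : ℕ) : (List.finRange n).map Fin.val = List.range n :=
  List.ext_getElem (by simp) (by simp)

theorem adjRow_eq (i : Fin n) : adjRow G i = (List.range n).map (adjBit G i) := by
  rw [← map_val_finRange, List.map_map]
  refine List.map_congr_left fun j _ => ?_
  simp [adjBit]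

theorem encodeGraph_eq : encodeGraph ⟨n, G⟩ =
    (List.range n).flatMap fun i => ((List.range n).map (adjBit G i)).map some ++ [none] := by
  rw [encodeGraph, encodeRows, ← map_val_finRange, List.flatMap_map, List.flatMap_map]
  simp only [adjRow_eq, map_val_finRange]

theorem foldl_readStep_row (i : ℕ) (b : ℕ → Bool) (E : List (ℕ × ℕ)) (m : ℕ) :
    (((List.range m).map b).map some).foldl readStep (i, 0, E) =
      (i, m, ((List.range m).filter fun j => b j && Nat.ble (j + 1) i).reverse.map
        (fun j => (i, j)) ++ E) := by
  induction m with
  | zero => rfl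
  | succ m ih =>
    rw [List.range_succ, List.map_append, List.map_append, List.foldl_append, ih,
      List.filter_append, List.map_singleton, List.map_singleton, List.foldl_cons, List.foldl_nil]
    by_cases h : (b m && Nat.ble (m + 1) i) = true
    · simp [readStep, h]
    · simp [readStep, h]

theorem readGraph_encodeGraph : readGraph (encodeGraph ⟨n, G⟩) = (n, 0, edges G n) := by
  have key : ∀ m, ((List.range m).flatMap fun i =>
      ((List.range n).map (adjBit G i)).map some ++ [none]).foldl readStep (0, 0, []) =
      (m, 0, edges G m) := by
    intro m
    induction m with
    | zero => rfl
    | succ m ih =>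
      rw [List.range_succ, List.flatMap_append, List.foldl_append, ih, List.flatMap_singleton,
        List.foldl_append, foldl_readStep_row]
      rfl
  rw [readGraph, encodeGraph_eq, key]

theorem mem_edges {m : ℕ} {e : ℕ × ℕ} :
    e ∈ edges G m ↔ e.1 < m ∧ e.2 < n ∧ adjBit G e.1 e.2 = true ∧ e.2 < e.1 := by
  obtain ⟨i, j⟩ := e
  induction m with
  | zero => simp [edges]
  | succ m ih =>
    simp only [edges, List.mem_append, ih, List.mem_map, List.mem_reverse, List.mem_filter,
      List.mem_range, Bool.and_eq_true, Nat.ble_eq, Prod.mk.injEq]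
    constructor
    · rintro (⟨j', h, rfl, rfl⟩ | h)
      · exact ⟨Nat.lt_succ_self _, h.1, h.2.1, h.2.2⟩
      · exact ⟨h.1.trans (Nat.lt_succ_self _), h.2⟩
    · rintro ⟨h1, h2⟩
      rcases Nat.lt_succ_iff_lt_or_eq.1 h1 with h | rfl
      · exact Or.inr ⟨h, h2⟩
      · exact Or.inl ⟨j, ⟨h2.1, h2.2.1, h2.2.2⟩, rfl, rfl⟩

theorem mem_edges_iff_adj {u v : Fin n} : ((u : ℕ), (v : ℕ)) ∈ edges G n ↔ G.Adj u v ∧ v < u := by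
  rw [mem_edges]
  simp [adjBit]

theorem lt_of_mem_edges {e : ℕ × ℕ} (he : e ∈ edges G n) : e.1 < n ∧ e.2 < n :=
  ⟨(mem_edges.1 he).1, (mem_edges.1 he).2.1⟩

theorem nodup_edges (m : ℕ) : (edges G m).Nodup := by
  induction m with
  | zero => exact List.nodup_nil
  | succ m ih =>
    refine List.Nodup.append ?_ ih fun e h1 h2 => ?_
    · refine List.Nodup.map (fun a b h => (Prod.mk.inj h).2) ?_
      exact List.nodup_reverse.2 (List.nodup_range.filter _)
    · obtain ⟨j, -, rfl⟩ := List.mem_map.1 h1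
      exact lt_irrefl _ (mem_edges.1 h2).1

theorem nodup_map_edges : ((edges G n).map fun e => s(e.1, e.2)).Nodup := by
  refine (nodup_edges n).map_on fun e he f hf h => ?_
  have h1 := (mem_edges.1 he).2.2.2
  have h2 := (mem_edges.1 hf).2.2.2
  rcases Sym2.eq_iff.1 h with ⟨h3, h4⟩ | ⟨h3, h4⟩
  · exact Prod.ext h3 h4
  · omega

theorem outDeg_add_inDeg (u : Fin n) :
    outDeg (edges G n) u + inDeg (edges G n) u = (G.neighborSet u).ncard := by
  set E := edges G n
  set l := (E.filter fun e => Nat.beq e.1 u).map Prod.snd ++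
    (E.filter fun e => Nat.beq e.2 u).map Prod.fst with hl
  have hlen : outDeg E u + inDeg E u = l.length := by
    simp [hl, outDeg, inDeg, List.countP_eq_length_filter]
  have hnd : l.Nodup := by
    have h1 := nodup_edges (G := G) n
    refine List.Nodup.append ((h1.filter _).map_on fun e he f hf h => ?_)
      ((h1.filter _).map_on fun e he f hf h => ?_) fun v hv hv' => ?_
    · have := (List.mem_filter.1 he).2
      have := (List.mem_filter.1 hf).2
      rw [Nat.beq_eq] at *
      exact Prod.ext (by omega) h
    · have := (List.mem_filter.1 he).2
      have := (List.mem_filter.1 hf).2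
      rw [Nat.beq_eq] at *
      exact Prod.ext h (by omega)
    · obtain ⟨e, he, rfl⟩ := List.mem_map.1 hv
      obtain ⟨f, hf, hef⟩ := List.mem_map.1 hv'
      rw [List.mem_filter, Nat.beq_eq] at he hf
      have h1 := (mem_edges.1 he.1).2.2.2
      have h2 := (mem_edges.1 hf.1).2.2.2
      omega
  have hset : Fin.val '' G.neighborSet u = (l.toFinset : Set ℕ) := by
    ext v
    simp only [hl, Set.mem_image, SimpleGraph.mem_neighborSet, SetLike.mem_coe,
      List.mem_toFinset, List.mem_append, List.mem_map, List.mem_filter, Nat.beq_eq]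
    constructor
    · rintro ⟨w, hw, rfl⟩
      rcases lt_or_gt_of_ne hw.ne with h | h
      · exact Or.inr ⟨(w, u), ⟨mem_edges_iff_adj.2 ⟨hw.symm, h⟩, rfl⟩, rfl⟩
      · exact Or.inl ⟨(u, w), ⟨mem_edges_iff_adj.2 ⟨hw, h⟩, rfl⟩, rfl⟩
    · rintro (⟨⟨i, j⟩, ⟨he, rfl⟩, rfl⟩ | ⟨⟨i, j⟩, ⟨he, rfl⟩, rfl⟩)
      · exact ⟨⟨j, (lt_of_mem_edges he).2⟩, (mem_edges_iff_adj (v := ⟨j, _⟩).1 he).1, rfl⟩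
      · exact ⟨⟨i, (lt_of_mem_edges he).1⟩, (mem_edges_iff_adj (u := ⟨i, _⟩).1 he).1.symm, rfl⟩
  rw [hlen, ← List.toFinset_card_of_nodup hnd, ← Set.ncard_coe_finset, ← hset,
    Set.ncard_image_of_injective _ Fin.val_injective]

theorem mem_core {k : ℕ} {u v : Fin n} : ((u : ℕ), (v : ℕ)) ∈ core k (edges G n) ↔
    (G.Adj u v ∧ v < u) ∧ k < (G.neighborSet u).ncard ∧ k < (G.neighborSet v).ncard := by
  simp only [core, List.mem_filter, mem_edges_iff_adj, Bool.and_eq_true, Nat.ble_eq,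
    outDeg_add_inDeg, Nat.succ_le_iff]

theorem core_or_core {k : ℕ} {u v : Fin n} (huv : G.Adj u v) (hu : k < (G.neighborSet u).ncard)
    (hv : k < (G.neighborSet v).ncard) :
    ((u : ℕ), (v : ℕ)) ∈ core k (edges G n) ∨ ((v : ℕ), (u : ℕ)) ∈ core k (edges G n) := by
  rcases lt_or_gt_of_ne huv.ne with h | h
  · exact Or.inr (mem_core.2 ⟨⟨huv.symm, h⟩, hv, hu⟩)
  · exact Or.inl (mem_core.2 ⟨⟨huv, h⟩, hu, hv⟩)

theorem lt_of_mem_core {k : ℕ} : ∀ e ∈ core k (edges G n), e.1 < n ∧ e.2 < n := fun _ he =>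
  lt_of_mem_edges (List.mem_of_mem_filter he)

theorem mem_final_or {k : ℕ} {u v : Fin n} (huv : G.Adj u v) (hu : k < (G.neighborSet u).ncard)
    (hv : k < (G.neighborSet v).ncard) :
    ((u : ℕ), (v : ℕ)) ∈ (final k n (core k (edges G n))).1 ∨
      ((v : ℕ), (u : ℕ)) ∈ (final k n (core k (edges G n))).1 := by
  have hinv := invariant_final k (lt_of_mem_core (G := G) (k := k))
  rcases core_or_core huv hu hv with h | h
  · exact hinv.mem_or' h
  · exact (hinv.mem_or' h).symm

/-- The orientation found by the algorithm is extended to a good orientation: an edge with an end of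
degree at most `k` is directed away from this end. -/
theorem localStarArboricity_le_of_test {k : ℕ} (h : test k n (edges G n) = true) :
    localStarArboricity G ≤ k := by
  set F := (final k n (core k (edges G n))).1
  have hout : ∀ e ∈ F, outDeg F e.1 < k := by
    intro e he
    have := List.all_eq_true.1 h e he
    rw [Bool.not_eq_true', ← Bool.not_eq_true, Nat.ble_eq, not_le] at this
    exact this
  rw [localStarArboricity_le_iff]
  refine ⟨fun u v => ((u : ℕ), (v : ℕ)) ∈ F ∨ (G.neighborSet u).ncard ≤ k, ?_, fun u hu => ?_⟩
  · intro u v huv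
    rcases le_or_gt (G.neighborSet u).ncard k with h1 | h1
    · exact Or.inl (Or.inr h1)
    rcases le_or_gt (G.neighborSet v).ncard k with h2 | h2
    · exact Or.inr (Or.inr h2)
    exact (mem_final_or huv h1 h2).imp Or.inl Or.inl
  · simp only [hu.not_ge, or_false]
    by_cases hne : ∃ v : Fin n, ((u : ℕ), (v : ℕ)) ∈ F
    · obtain ⟨v, hv⟩ := hne
      refine lt_of_le_of_lt ?_ (hout _ hv)
      rw [← Set.ncard_image_of_injective _ Fin.val_injective]
      have hsub : Fin.val '' {v : Fin n | ((u : ℕ), (v : ℕ)) ∈ F} ⊆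
          (((F.filter fun e => Nat.beq e.1 u).map Prod.snd).toFinset : Set ℕ) := by
        rintro _ ⟨w, hw, rfl⟩
        simp only [SetLike.mem_coe, List.mem_toFinset, List.mem_map, List.mem_filter, Nat.beq_eq]
        exact ⟨(u, w), ⟨hw, rfl⟩, rfl⟩
      refine (Set.ncard_le_ncard hsub (Finset.finite_toSet _)).trans ?_
      rw [Set.ncard_coe_finset]
      refine (List.toFinset_card_le _).trans ?_
      rw [List.length_map, ← List.countP_eq_length_filter]
      rfl
    · have hempty : {v : Fin n | ((u : ℕ), (v : ℕ)) ∈ F} = ∅ :=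
        Set.eq_empty_of_forall_notMem fun v hv => hne ⟨v, hv⟩
      rw [hempty, Set.ncard_empty]
      by_contra hk
      -- For `k = 0` no edge may exist, as the tail of an edge in `F` has positive out-degree.
      obtain rfl : k = 0 := by omega
      obtain ⟨w, hw⟩ := (Set.ncard_pos (Set.toFinite _)).1 hu
      have hw' : 0 < (G.neighborSet w).ncard :=
        (Set.ncard_pos (Set.toFinite _)).2 ⟨u, SimpleGraph.Adj.symm hw⟩
      rcases mem_final_or hw hu hw' with h1 | h1 <;> exact absurd (hout _ h1) (Nat.not_lt_zero _)

theorem test_of_localStarArboricity_le {k : ℕ} (h : localStarArboricity G ≤ k) :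
    test k n (edges G n) = true := by
  classical
  obtain ⟨D, hD⟩ := localStarArboricity_le_iff.1 h
  rw [test, List.all_eq_true]
  intro e₀ he₀
  rw [Bool.not_eq_true', ← Bool.not_eq_true, Nat.ble_eq]
  intro hk
  have hlt := lt_of_mem_core (G := G) (k := k)
  obtain ⟨⟨i, j⟩, he, hcard⟩ := exists_le_card_of_stuck (invariant_final k hlt) hlt
    (nodup_map_edges.sublist (List.filter_sublist.map _)) (not_liftable_final k hlt) he₀ hk
    (fun i j => ∃ (hi : i < n) (hj : j < n), D ⟨i, hi⟩ ⟨j, hj⟩) (by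
      rintro ⟨i, j⟩ he
      obtain ⟨hi, hj⟩ := hlt _ he
      have := ((mem_core (u := ⟨i, hi⟩) (v := ⟨j, hj⟩)).1 he).1.1
      exact (hD.total _ _ this).imp (fun h => ⟨hi, hj, h⟩) fun h => ⟨hj, hi, h⟩)
  obtain ⟨hi, hj⟩ := hlt _ he
  obtain ⟨-, hdi, hdj⟩ := (mem_core (u := ⟨i, hi⟩) (v := ⟨j, hj⟩)).1 he
  have key : ∀ u : Fin n, ((Finset.range n).filter fun j =>
      ∃ (hi : (u : ℕ) < n) (hj : j < n), D ⟨u, hi⟩ ⟨j, hj⟩).card = {v | D u v}.ncard := by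
    intro u
    rw [← Set.ncard_image_of_injective _ Fin.val_injective, ← Set.ncard_coe_finset]
    congr 1
    ext j
    simp only [Finset.coe_filter, Finset.mem_range, Set.mem_image]
    constructor
    · rintro ⟨hj, _, _, h⟩
      exact ⟨⟨j, hj⟩, h, rfl⟩
    · rintro ⟨v, hv, rfl⟩
      exact ⟨v.2, u.2, v.2, hv⟩
  rcases hcard with h1 | h1
  · exact absurd (hD.ncard_lt _ hdi) (not_lt.2 (h1.trans (key ⟨i, hi⟩).le))
  · exact absurd (hD.ncard_lt _ hdj) (not_lt.2 (h1.trans (key ⟨j, hj⟩).le))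

theorem localStarArboricity_le (G : SimpleGraph (Fin n)) : localStarArboricity G ≤ n := by
  refine localStarArboricity_le_iff.2 ⟨fun _ _ => True, fun _ _ _ => Or.inl trivial, fun u hu => ?_⟩
  have := Set.ncard_le_card (G.neighborSet u)
  rw [Nat.card_fin] at this
  omega

theorem algorithm_encodeGraph : algorithm (encodeGraph ⟨n, G⟩) = localStarArboricity G := by
  have htest : ∀ k, test k n (edges G n) = true ↔ localStarArboricity G ≤ k := fun k =>
    ⟨localStarArboricity_le_of_test, test_of_localStarArboricity_le⟩
  have key : ∀ m, failures n (edges G n) m = (m, min m (localStarArboricity G)) := by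
    intro m
    induction m with
    | zero => simp [failures]
    | succ m ih =>
      unfold failures at ih ⊢
      rw [Function.iterate_succ_apply', ih, failuresStep]
      by_cases h : localStarArboricity G ≤ m
      · simp only [(htest m).2 h, if_true, Prod.mk.injEq, true_and]
        omega
      · simp only [(htest m).not.2 h, Prod.mk.injEq, true_and]
        simp only [Bool.false_eq_true, if_false]
        omega
  rw [algorithm, readGraph_encodeGraph]
  simp only [key]
  exact min_eq_right (localStarArboricity_le G)

end StarArboricity

/-- The function that maps a finite graph, given by its adjacency matrix, to (the binary
representation of) its local star arboricity is computed by a Turing machine whose number of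
steps is bounded by a polynomial in the length of its input. -/
theorem mainTheorem10 :
    Nonempty (Turing.TM2ComputableInPolyTime GraphCover.encodeGraph
      Computability.encodingNatBool.encode
      (fun G : GraphCover.FiniteGraph => GraphCover.localStarArboricity G.2)) :=
  StarArboricity.polyTime_algorithm.nonempty_tm2 fun G =>
    congrArg Computability.encodeNat (StarArboricity.algorithm_encodeGraph (G := G.2))
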